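/- **Setting.** Let $\Gamma$ be a bipartite graph (multiple edges allowed) embedded in the torus $\mathbb T$ so that all faces are discs. A *zig-zag path* is a closed path in $\Gamma$ that turns maximally left at white vertices and maximally right at black vertices. $\Gamma$ is *minimal* if lifts of zig-zag paths to the universal cover of $\mathbb T$ have no self-intersections (in particular are not closed), and no two lifts form a parallel bigon, i.e. pass through two common edges in the same order. $\mathcal X_\Gamma=H^1(\Gamma,\mathbb C^\times)$ is the space of edge weights $\mathrm{wt}:E\to\mathbb C^\times$ modulo gauge equivalence. For a zig-zag path $\alpha$, the *monodromy* $C_\alpha:\mathcal X_\Gamma\to\mathbb C^\times$ is the product of the weights of the edges that $\alpha$ walks from black to white, divided by the product of the weights of the edges that it walks from white to black. A *cyclic chain of $n\ge 1$ hexagons* consists of distinct hexagonal faces $f_k$ ($k\in\mathbb Z/n$), where $f_{k-1}$ and $f_k$ share an edge (rung) whose white endpoint $w_k$, on the left of the chain, and black endpoint $b_k$, on the right, are trivalent. The two other corners of $f_k$ are a black vertex on the left, joined to $w_k$ and $w_{k+1}$ by edges of $f_k$, and a white vertex on the right, joined to $b_k$ and $b_{k+1}$ by edges of $f_k$; these two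 vertices may have further edges leading away from the chain. The edges of the chain other than the rungs form, on the left and on the right, two zig-zag paths $\alpha_1,\alpha_2$ bounding the chain. The *geometric $R$-matrix transformation* based at $f_k$ is the following partially defined map $\mathcal X_\Gamma\dashrightarrow\mathcal X_\Gamma$. Insert into $f_k$ a bigon joining its black corner on the left to its white corner on the right, with opposite weights $\pm y$, $y\in\mathbb C^\times$. Then perform $n$ spider moves (together with the contractions and uncontractions of two-valent vertices that are needed for them), which move the bigon edge nearer to $f_{k+1}$ successively across the rungs between $f_k,f_{k+1}$; $f_{k+1},f_{k+2}$; $\dots$; $f_{k-1},f_k$. Here $y$ is chosen so that the bigon that is again present in $f_k$ has opposite weights; this bigon is deleted. The spider move at a square with cyclically ordered side weights $a,b,c,d$ and with legs of weight $1$ replaces each side weight by the opposite one divided by $\Delta=ac+bd$, and is defined if $\Delta\neq0$. **Proposition.** Let $\Gamma$ be minimal, and let $\alpha_1\ne\alpha_2$ be the two zig-zag paths bounding a cyclic chain of hexagons in $\Gamma$. For every $k$, the geometric $R$-matrix transformation based at $f_k$ is defined at the class of every edge weight outside the zero set of some nonzero polynomial in the edge weights. Whenever it maps $\omega\in\mathcal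 X_\Gamma$ to $\omega'\in\mathcal X_\Gamma$, $$C_{\alpha_1}(\omega')=C_{\alpha_2}(\omega),\qquad C_{\alpha_2}(\omega')=C_{\alpha_1}(\omega),\qquad C_\alpha(\omega')=C_\alpha(\omega)\ \text{ for every zig-zag path }\alpha\neq\alpha_1,\alpha_2 .$$ -/

import Mathlib

namespace TorusDimer

open Equiv

/-- A bipartite graph (multiple edges allowed) drawn on a closed oriented surface with all faces
discs, encoded by its rotation system.  `E` is the set of edges; `black e` (resp. `white e`) is the
edge that follows `e` counterclockwise around the black (resp. white) endpoint of `e`. -/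
structure BipartiteMap (E : Type*) where
  black : Perm E
  white : Perm E

namespace BipartiteMap

variable {E : Type*} (M : BipartiteMap E)

/-- The set `B` of black vertices: the cycles of `black`. -/
def Black : Type _ := Quotient (Perm.SameCycle.setoid M.black)

/-- The set `W` of white vertices: the cycles of `white`. -/
def White : Type _ := Quotient (Perm.SameCycle.setoid M.white)

/-- The black endpoint of an edge. -/
def blackEnd (e : E) : M.Black := Quotient.mk (Perm.SameCycle.setoid M.black) e

/-- The white endpoint of an edge. -/
def whiteEnd (e : E) : M.White := Quotient.mk (Perm.SameCycle.setoid M.white) e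

/-- Walk with a face on the left.  After going along `e` from black to white, one turns maximally
left at both of the next two vertices, which gives the next edge of the boundary of the face that
is walked from black to white. -/
def facePerm : Perm E := M.black⁻¹ * M.white⁻¹

/-- The faces.  The edges in the class of a face `f` are those that are walked from black to
white on the counterclockwise boundary of `f`; a face with `m` elements has `2 * m` sides. -/
def Face : Type _ := Quotient (Perm.SameCycle.setoid M.facePerm)

/-- The face to the left of `e` walked from black to white. -/
def faceOf (e : E) : M.Face := Quotient.mk (Perm.SameCycle.setoid M.facePerm) e

/-- The surface is a torus: the graph is nonempty and connected, and the Euler characteristic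
`#B + #W - #E + #F` vanishes. -/
def IsTorus : Prop :=
  Nonempty E ∧
  MulAction.IsPretransitive (Subgroup.closure {M.black, M.white} : Subgroup (Perm E)) E ∧
  Nat.card M.Black + Nat.card M.White + Nat.card M.Face = Nat.card E

/-! ### Zig-zag paths -/

/-- One step along a zig-zag path.  The oriented edge `(e, true)` is `e` walked from black to white
and `(e, false)` is `e` walked from white to black.  A zig-zag path turns maximally left at white
vertices and maximally right at black vertices. -/
def zigzagPerm : Perm (E × Bool) where
  toFun d := if d.2 then (M.white⁻¹ d.1, false) else (M.black d.1, true)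
  invFun d := if d.2 then (M.black⁻¹ d.1, false) else (M.white d.1, true)
  left_inv := by rintro ⟨e, _ | _⟩ <;> simp
  right_inv := by rintro ⟨e, _ | _⟩ <;> simp

/-- The set `Z` of zig-zag paths. -/
def Zigzag : Type _ := Quotient (Perm.SameCycle.setoid M.zigzagPerm)

/-- The zig-zag path through an oriented edge. -/
def zigzagOf (d : E × Bool) : M.Zigzag := Quotient.mk (Perm.SameCycle.setoid M.zigzagPerm) d

/-! ### Homology -/

open scoped Classical in
/-- `H₁(Γ, ℤ)`: integral 1-cycles of the graph.  Edges are oriented from black to white. -/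
def H1 [Fintype E] : AddSubgroup (E → ℤ) where
  carrier := {c | (∀ b : M.Black, ∑ e with M.blackEnd e = b, c e = 0) ∧
    ∀ w : M.White, ∑ e with M.whiteEnd e = w, c e = 0}
  zero_mem' := by simp
  add_mem' := by
    rintro c d ⟨h1, h2⟩ ⟨h3, h4⟩
    exact ⟨fun b => by simp [Finset.sum_add_distrib, h1, h3],
      fun w => by simp [Finset.sum_add_distrib, h2, h4]⟩
  neg_mem' := by
    rintro c ⟨h1, h2⟩
    exact ⟨fun b => by simp [h1], fun w => by simp [h2]⟩

open scoped Classical in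
/-- The 1-chain of a zig-zag path. -/
noncomputable def zigzagChain (α : M.Zigzag) (e : E) : ℤ :=
  (if M.zigzagOf (e, true) = α then 1 else 0) - (if M.zigzagOf (e, false) = α then 1 else 0)

theorem zigzagOf_black (e : E) : M.zigzagOf (M.black e, true) = M.zigzagOf (e, false) :=
  Quotient.sound ⟨-1, by rw [zpow_neg_one, Perm.inv_eq_iff_eq]; simp [zigzagPerm]⟩

theorem zigzagOf_white (e : E) : M.zigzagOf (M.white e, true) = M.zigzagOf (e, false) :=
  Quotient.sound ⟨1, by simp [zigzagPerm]⟩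

theorem blackEnd_black (e : E) : M.blackEnd (M.black e) = M.blackEnd e :=
  Quotient.sound ⟨-1, by simp⟩

theorem whiteEnd_white (e : E) : M.whiteEnd (M.white e) = M.whiteEnd e :=
  Quotient.sound ⟨-1, by simp⟩

open scoped Classical in
theorem zigzagChain_mem_H1 [Fintype E] (α : M.Zigzag) : M.zigzagChain α ∈ M.H1 := by
  constructor
  · intro v
    have h := Equiv.sum_comp M.black (fun e => if M.blackEnd e = v then
      (if M.zigzagOf (e, true) = α then (1 : ℤ) else 0) else 0)
    simp only [blackEnd_black, zigzagOf_black] at h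
    simp only [zigzagChain, Finset.sum_sub_distrib, Finset.sum_filter, h, sub_self]
  · intro v
    have h := Equiv.sum_comp M.white (fun e => if M.whiteEnd e = v then
      (if M.zigzagOf (e, true) = α then (1 : ℤ) else 0) else 0)
    simp only [whiteEnd_white, zigzagOf_white] at h
    simp only [zigzagChain, Finset.sum_sub_distrib, Finset.sum_filter, h, sub_self]

/-- The class `[α]` in `H₁(Γ, ℤ)` of a zig-zag path. -/
noncomputable def zigzagClass [Fintype E] (α : M.Zigzag) : M.H1 :=
  ⟨M.zigzagChain α, M.zigzagChain_mem_H1 α⟩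

open scoped Classical in
/-- The 1-chain `∂f` of the counterclockwise boundary of a face: its black-to-white edges are the
`e` in the class of `f`, and its white-to-black edges are the corresponding `white⁻¹ e`. -/
noncomputable def faceBoundary (f : M.Face) (e : E) : ℤ :=
  (if M.faceOf e = f then 1 else 0) - (if M.faceOf (M.white e) = f then 1 else 0)

/-- The 1-chains that are boundaries on the surface.  A 1-cycle of the graph is trivial in
`H₁(𝕋, ℤ)` exactly if it lies in this subgroup. -/
noncomputable def boundaries : AddSubgroup (E → ℤ) :=
  AddSubgroup.closure (Set.range M.faceBoundary)

/-! ### Minimality -/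

/-- The 1-chain of the path from the black endpoint of the oriented edge `d` to the black endpoint
of the next oriented edge of the zig-zag path through `d`. -/
def stepChain [DecidableEq E] (d : E × Bool) : E → ℤ :=
  if d.2 then Pi.single d.1 1 - Pi.single (M.white⁻¹ d.1) 1 else 0

/-- The 1-chain of the path that follows the zig-zag path through `d` for `m` steps, from the black
endpoint of the first edge to the black endpoint of the last edge. -/
def displacement [DecidableEq E] (d : E × Bool) (m : ℕ) : E → ℤ :=
  ∑ i ∈ Finset.range m, M.stepChain ((M.zigzagPerm ^ i) d)

/-- Minimality of a graph on the torus.  Zig-zag paths meet (themselves or each other) at edges.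
Since the fundamental group of the torus is its first homology group, two paths in the graph
from one edge to another, lifted to the universal cover with the same starting edge, end at the
same lifted edge exactly if their 1-chains differ by a boundary.  The first condition says that
a lift of a zig-zag path never visits a lifted edge twice (in particular it is not a closed curve);
the second says that the lifts of the two zig-zag paths through an edge do not both, further along
in their own directions, pass through another common edge (no parallel bigon). -/
def IsMinimal [DecidableEq E] : Prop :=
  (∀ (d : E × Bool) (m : ℕ), 0 < m → ((M.zigzagPerm ^ m) d).1 = d.1 →
    M.displacement d m ∉ M.boundaries) ∧
  (∀ (d d' : E × Bool) (m m' : ℕ), d.1 = d'.1 → d ≠ d' → 0 < m → 0 < m' →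
    ((M.zigzagPerm ^ m) d).1 = ((M.zigzagPerm ^ m') d').1 →
    M.displacement d m - M.displacement d' m' ∉ M.boundaries)

/-! ### Weights and monodromies -/

/-- Gauge equivalence of edge weights. -/
def GaugeEquiv (wt₁ wt₂ : E → ℂˣ) : Prop :=
  ∃ (f : M.Black → ℂˣ) (g : M.White → ℂˣ),
    ∀ e, wt₁ e = (f (M.blackEnd e))⁻¹ * wt₂ e * g (M.whiteEnd e)

theorem gaugeEquiv_equivalence : Equivalence M.GaugeEquiv where
  refl wt := ⟨1, 1, fun e => by simp⟩
  symm := by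
    rintro wt₁ wt₂ ⟨f, g, h⟩
    refine ⟨f⁻¹, g⁻¹, fun e => ?_⟩
    rw [h e]
    simp only [Pi.inv_apply, inv_inv]
    rw [← mul_assoc, mul_inv_cancel_right, mul_inv_cancel_left]
  trans := by
    rintro wt₁ wt₂ wt₃ ⟨f, g, h⟩ ⟨f', g', h'⟩
    refine ⟨f * f', g * g', fun e => ?_⟩
    rw [h e, h' e]
    simp only [Pi.mul_apply, mul_inv]
    ac_rfl

/-- Gauge equivalence as a setoid. -/
def gaugeSetoid : Setoid (E → ℂˣ) := ⟨M.GaugeEquiv, M.gaugeEquiv_equivalence⟩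

/-- The space `𝓧_Γ` of edge weights modulo gauge equivalence. -/
def X : Type _ := Quotient M.gaugeSetoid

/-- The class `[wt]` in `𝓧_Γ` of an edge weight. -/
def toX (wt : E → ℂˣ) : M.X := Quotient.mk M.gaugeSetoid wt

open scoped Classical in
theorem prod_zpow_gauge [Fintype E] {V : Type*} (v : E → V) (f : V → ℂˣ) (c : E → ℤ)
    (h : ∀ b, ∑ e with v e = b, c e = 0) : ∏ e, f (v e) ^ c e = 1 := by
  rw [← Finset.prod_fiberwise_of_maps_to (s := Finset.univ) (t := Finset.univ.image v) (g := v)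
    (fun e _ => Finset.mem_image_of_mem v (Finset.mem_univ e))]
  refine Finset.prod_eq_one fun b _ => ?_
  have hpow : ∀ s : Finset E, ∏ e ∈ s, f b ^ c e = f b ^ ∑ e ∈ s, c e := by
    intro s
    induction s using Finset.induction_on with
    | empty => simp
    | insert a s ha ih => rw [Finset.prod_insert ha, Finset.sum_insert ha, zpow_add, ih]
  calc ∏ e with v e = b, f (v e) ^ c e = ∏ e with v e = b, f b ^ c e :=
        Finset.prod_congr rfl fun e he => by rw [(Finset.mem_filter.1 he).2]
    _ = 1 := by rw [hpow, h b, zpow_zero]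

/-- The monodromy `χ^[L]` around a 1-cycle: the product of the weights of the edges walked from
black to white divided by the product of the weights of those walked from white to black. -/
def monodromy [Fintype E] (c : M.H1) : M.X → ℂˣ :=
  Quotient.lift (fun wt : E → ℂˣ => ∏ e, wt e ^ c.1 e) (by
    rintro wt₁ wt₂ ⟨f, g, h⟩
    have hb := prod_zpow_gauge M.blackEnd f c.1 c.2.1
    have hw := prod_zpow_gauge M.whiteEnd g c.1 c.2.2
    simp only [h, mul_zpow, Finset.prod_mul_distrib, inv_zpow, Finset.prod_inv_distrib, hb, hw,
      inv_one, one_mul, mul_one])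

/-- The monodromy `C_α` around a zig-zag path. -/
noncomputable def C [Fintype E] (α : M.Zigzag) : M.X → ℂˣ := M.monodromy (M.zigzagClass α)

/-! ### Cyclic chains of hexagons -/

/-- A cyclic chain of `n` hexagons `f_k`, drawn vertically with the index `k` increasing upwards.
Between `f_(k-1)` and `f_k` lies the rung `r k`, with a trivalent white endpoint `w k` on the left
and a trivalent black endpoint `b k` on the right.  The hexagon `f_k` has two further corners:
a black one `bl k` on the left, joined to `w k` by `p k` and to `w (k+1)` by `q k`, and a white one
`wr k` on the right, joined to `b k` by `s k` and to `b (k+1)` by `t k`.  Arbitrarily many further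
edges may leave `bl k` to the left and `wr k` to the right. -/
structure HexChain (n : ℕ) where
  (p q r s t : ZMod n → E)
  /-- the edges at `w k`, counterclockwise, are `r k`, `p k`, `q (k-1)` -/
  white_r : ∀ k, M.white (r k) = p k
  white_p : ∀ k, M.white (p (k + 1)) = q k
  white_q : ∀ k, M.white (q k) = r (k + 1)
  /-- the edges at `b k`, counterclockwise, are `r k`, `t (k-1)`, `s k` -/
  black_r : ∀ k, M.black (r (k + 1)) = t k
  black_t : ∀ k, M.black (t k) = s (k + 1)
  black_s : ∀ k, M.black (s k) = r k
  /-- at the corner `bl k` of `f_k`, the edge after `p k` is `q k` -/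
  black_p : ∀ k, M.black (p k) = q k
  /-- at the corner `wr k` of `f_k`, the edge after `t k` is `s k` -/
  white_t : ∀ k, M.white (t k) = s k
  /-- `f_k` is a hexagon: its three sides walked from black to white are distinct -/
  hexagon : ∀ k, [p k, s k, r (k + 1)].Nodup
  /-- the `n` hexagons are distinct faces -/
  distinct : ∀ k l, M.faceOf (p k) = M.faceOf (p l) → k = l

namespace HexChain

variable {M} {n : ℕ} (H : M.HexChain n)

/-- The zig-zag path that bounds the chain on the left; it goes up through all `p k` (from white to
black) and `q k` (from black to white). -/
def left : M.Zigzag := M.zigzagOf (H.q 0, true)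

/-- The zig-zag path that bounds the chain on the right; it goes up through all `s k` (from black to
white) and `t k` (from white to black). -/
def right : M.Zigzag := M.zigzagOf (H.s 0, true)

end HexChain

end BipartiteMap

/-! ### Moves of weighted graphs -/

/-- A bipartite graph on a surface with an edge weight. -/
structure WeightedMap (E : Type*) extends BipartiteMap E where
  wt : E → ℂˣ

/-- For an edge `e` that is a fixed point of a rotation `σ`: put `e` immediately before `f`. -/
def insertBefore {F : Type*} [DecidableEq F] (e f : F) (σ : Perm F) : Perm F := swap e f * σ

/-- Take the edge `e` out of its cycle of the rotation `σ` (it becomes a fixed point). -/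
def erase {F : Type*} [DecidableEq F] (e : F) (σ : Perm F) : Perm F := swap e (σ e) * σ

/-- `G'` arises from `G` by contracting the two-valent white vertex whose edges are `a` and `b`;
equivalently `G` arises from `G'` by an uncontraction.  The black vertices at the other ends of `a`
and `b`, which are distinct and of degree at least two, are merged, and `a`, `b` disappear; `ι`
identifies the edges of `G'` with the remaining edges of `G`.  The weights are first changed by a
gauge transformation at the black endpoint of `a` so that the weights of `a` and `b` agree. -/
structure IsContraction {F F' : Type*} (G : WeightedMap F) (G' : WeightedMap F') (ι : F' → F)
    (a b : F) : Prop where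
  injective : Function.Injective ι
  range : ∀ e, e ∈ Set.range ι ↔ e ≠ a ∧ e ≠ b
  ne : a ≠ b
  white_a : G.white a = b
  white_b : G.white b = a
  not_same : G.blackEnd a ≠ G.blackEnd b
  degree_a : G.black a ≠ a
  degree_b : G.black b ≠ b
  white_eq : ∀ e, ι (G'.white e) = G.white (ι e)
  black_eq_a : ∀ e, G.black (ι e) = a → ι (G'.black e) = G.black b
  black_eq_b : ∀ e, G.black (ι e) = b → ι (G'.black e) = G.black a
  black_eq : ∀ e, G.black (ι e) ≠ a → G.black (ι e) ≠ b → ι (G'.black e) = G.black (ι e)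
  wt_eq : ∀ e, G.blackEnd (ι e) = G.blackEnd a → G'.wt e = G.wt (ι e) * (G.wt b / G.wt a)
  wt_eq_of_ne : ∀ e, G.blackEnd (ι e) ≠ G.blackEnd a → G'.wt e = G.wt (ι e)

/-- `G'` arises from `G` by the spider move at a square face with two trivalent black corners.
Counterclockwise, one black corner has edges `u`, `x`, `q` and the other has edges `v`, `r`, `t`;
the square has sides `x`, `q`, `r`, `t`, with `q`, `r` meeting at the white corner `N`
and `t`, `x` at the white corner `S`, and the legs `u`, `v` lead to white vertices `U` and `V`.

After the move there are again two trivalent black vertices in the disc with vertices `N`, `U`, `S`,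
`V`: one is joined to `U`, `N`, `V` (and `N` is its leg) by the edges that carry the labels
`u`, `q`, `x`, the other is joined to `U`, `S`, `V` (and `S` is its leg) by the edges that carry the
labels `r`, `t`, `v`.  So with these labels the rotation at the black vertices is the same, while
`r` moves from `N` to `U` and `x` moves from `S` to `V`.  The square `u`, `x`, `v`, `r` is
the new square face. -/
structure IsSpiderMove {F : Type*} [DecidableEq F] (G G' : WeightedMap F) (u x q v r t : F) :
    Prop where
  nodup : [u, x, q, v, r, t].Nodup
  black_u : G.black u = x
  black_x : G.black x = q
  black_q : G.black q = u
  black_v : G.black v = r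
  black_r : G.black r = t
  black_t : G.black t = v
  white_q : G.white q = r
  white_t : G.white t = x
  black_eq : G'.black = G.black
  white_eq : G'.white = insertBefore x v (insertBefore r u (erase x (erase r G.white)))
  wt_eq_of_ne : ∀ e, e ∉ [u, x, q, v, r, t] → G'.wt e = G.wt e
  /-- The old square has opposite sides `x`, `r` and `q`, `t`; the new legs get weight `1` and each
  new side has the weight of the opposite old side (times the weight of the old leg at its white
  endpoint) divided by `Δ`. -/
  wt_eq : ∃ Δ : ℂˣ, (Δ : ℂ) = G.wt x * G.wt r + G.wt q * G.wt t ∧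
    G'.wt q = 1 ∧ G'.wt t = 1 ∧
    G'.wt u = G.wt u * G.wt t / Δ ∧ G'.wt r = G.wt u * G.wt r / Δ ∧
    G'.wt x = G.wt v * G.wt x / Δ ∧ G'.wt v = G.wt v * G.wt q / Δ

/-- The labels of the edges that remain when the edges `q`, `p` are contracted and the edges
`inr false`, `inr true` take over their roles. -/
def relabel {F : Type*} [DecidableEq F] (q p e : F) : F ⊕ Bool :=
  if e = p then Sum.inr true else if e = q then Sum.inr false else Sum.inl e

/-- The spider move at a square face with sides `x`, `q`, `r`, `t`, where `r` is a rung of the chain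
with edges `r`, `p`, `q` at its trivalent white endpoint and `r`, `t`, `s` at its trivalent black
endpoint.  To have two trivalent black corners, one first splits off the edges `x`, `q` from
the black corner at which they meet (an uncontraction, with new edges of weight `1`).
The spider move makes the white endpoint of `q`, `p` two-valent, and it is contracted.
As a result the edge `x` has moved across the rung. -/
def SpiderAcrossRung {F : Type*} [DecidableEq F] (G G' : WeightedMap F) (x q r t p s : F) : Prop :=
  ∃ G₁ G₂ : WeightedMap (F ⊕ Bool),
    IsContraction G₁ G Sum.inl (Sum.inr true) (Sum.inr false) ∧
    G₁.wt (Sum.inr true) = 1 ∧ G₁.wt (Sum.inr false) = 1 ∧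
    IsSpiderMove G₁ G₂ (Sum.inr true) (Sum.inl x) (Sum.inl q) (Sum.inl s) (Sum.inl r) (Sum.inl t) ∧
    IsContraction G₂ G' (relabel q p) (Sum.inl q) (Sum.inl p)

namespace BipartiteMap

variable {E : Type*} [DecidableEq E] {M : BipartiteMap E} {n : ℕ}

/-- Insert into the hexagon `f_k` a bigon joining `bl k` to `wr k`.  Its edges are labelled by
`Bool`; the lower edge is `low`, the upper edge is `!low`, and their weights are `y` and `-y`. -/
def HexChain.insertBigon (H : M.HexChain n) (k : ZMod n) (low : Bool) (y : ℂˣ) (wt : E → ℂˣ) :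
    WeightedMap (E ⊕ Bool) where
  black := insertBefore (Sum.inr low) (Sum.inr (!low))
    (insertBefore (Sum.inr (!low)) (Sum.inl (H.q k)) (Perm.sumCongr M.black 1))
  white := insertBefore (Sum.inr (!low)) (Sum.inr low)
    (insertBefore (Sum.inr low) (Sum.inl (H.s k)) (Perm.sumCongr M.white 1))
  wt := Sum.elim wt (fun i => if i = low then y else -y)

/-- The geometric R-matrix transformation on edge weights.  A bigon with opposite weights is
inserted into the hexagon `f_k`; by `n` spider moves its upper edge is moved across the
rungs `k+1`, `k+2`, ..., `k+n = k`, so that it arrives below the other edge of the bigon; the two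
edges then form a bigon in `f_k` whose weights are opposite, and this bigon is deleted. -/
def HexChain.RMatrixWeights (H : M.HexChain n) (k : ZMod n) (wt wt' : E → ℂˣ) : Prop :=
  ∃ (y y' : ℂˣ) (G : ℕ → WeightedMap (E ⊕ Bool)),
    G 0 = H.insertBigon k false y wt ∧
    (∀ j < n, SpiderAcrossRung (G j) (G (j + 1)) (Sum.inr true)
      (Sum.inl (H.q (k + j))) (Sum.inl (H.r (k + j + 1))) (Sum.inl (H.t (k + j)))
      (Sum.inl (H.p (k + j + 1))) (Sum.inl (H.s (k + j + 1)))) ∧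
    G n = H.insertBigon k true y' wt'

/-- The geometric R-matrix transformation on `𝓧_Γ`, as a relation between a point and its image
(it is only defined generically). -/
def HexChain.RMatrix (H : M.HexChain n) (k : ZMod n) (ω ω' : M.X) : Prop :=
  ∃ wt wt' : E → ℂˣ, M.toX wt = ω ∧ M.toX wt' = ω' ∧ H.RMatrixWeights k wt wt'

end BipartiteMap

end TorusDimer

/-! The cyclic chain is embedded: minimality and `left ≠ right` force all its edges `p`, `q`, `r`, `s`,
`t` to be distinct (`edge_injective`).  Hence every edge of the chain changes its weight in exactly
one of the `n` spider moves.  If `x` is the weight of the moving edge of the bigon, a move across a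
rung replaces (`IsRungWeightChange`)
`x ↦ p s x / Δ`, `q ↦ 1`, `t ↦ 1`, `r ↦ r / Δ`, `p ↦ p t / Δ`, `s ↦ s q / Δ`, with `Δ = x r + q t`.

The other edge of the bigon is never touched, so the condition of opposite weights at the end means
that `x` returns to its original value.  Multiplying `x ↦ p s x / Δ` over all rungs gives
`∏ Δ = ∏ p s`.  A zig-zag path that crosses the chain at a rung meets it in `s, r, q` or in `p, r, t`,
and the ratios `r / (s q)` and `p t / r` are unchanged.  The monodromies `∏ q / p` and `∏ s / t` of the
two bounding paths are multiplied by `∏ Δ / (q t) = ∏ p s / (q t)` and by its inverse, that is, they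
are exchanged (`IsTurnWeightChange.C_toX`, `C_left_toX`, `C_right_toX`).

For existence, `x ↦ p s x / (x r + q t)` is a Möbius map given by a lower triangular matrix.  So is the
composition over all rungs, which is `x ↦ P x / (R x + Q)` with `P = ∏ p s`, `Q = ∏ q t`, and
`x = (P - Q) / R` is a fixed point.  At this point each `Δ` is a quotient of two polynomials in the edge
weights (`fixedPointDenom`), which are positive where `p = 2` and all other weights are `1`
(`fixedPointDenom_pos`).  The graphs in between are the original graph with one fixed edge of the
bigon in `f_k` and the other one in some hexagon of the chain (`belowRung`, `aboveRung`), and one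
construction (`spiderAcrossRung_of_isRungWeightChange`) serves for all rungs. -/

namespace TorusDimer

open Equiv

/-! ### Insertion and erasure in a rotation -/

theorem insertBefore_apply {F : Type*} [DecidableEq F] {e f : F} {σ : Perm F} (h : σ e = e)
    (z : F) : insertBefore e f σ z = if z = e then f else if σ z = f then e else σ z := by
  have h' : σ z = e ↔ z = e := by rw [← h, σ.injective.eq_iff, h]
  simp only [insertBefore, Perm.mul_apply, swap_apply_def, h']

theorem erase_apply {F : Type*} [DecidableEq F] {e : F} {σ : Perm F}
    (z : F) : erase e σ z = if z = e then e else if σ z = e then σ e else σ z := by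
  simp only [erase, Perm.mul_apply, swap_apply_def]
  by_cases hz : z = e
  · subst hz; simp
  · have : σ z ≠ σ e := fun h => hz (σ.injective h)
    simp [hz, this]

/-- How the weights change when the edge `x` moves across the rung `r`, where `Δ` is the denominator
of the spider move.  The contraction is included: `p` and `x` have absorbed the old weight of `p`. -/
structure IsRungWeightChange {F : Type*} (w w' : F → ℂˣ) (x q r t p s : F) (Δ : ℂˣ) : Prop where
  delta : (Δ : ℂ) = w x * w r + w q * w t
  wt_x : w' x = w s * w p * w x / Δ
  wt_q : w' q = 1
  wt_r : w' r = w r / Δ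
  wt_t : w' t = 1
  wt_p : w' p = w p * w t / Δ
  wt_s : w' s = w s * w q / Δ
  wt_of_ne : ∀ e, e ∉ [x, q, r, t, p, s] → w' e = w e

/-- The edges at a trivalent black vertex. -/
theorem blackEnd_eq_of_threeCycle {F : Type*} (N : BipartiteMap F) {u x q e : F}
    (hu : N.black u = x) (hx : N.black x = q) (hq : N.black q = u) :
    N.blackEnd e = N.blackEnd q ↔ e = u ∨ e = x ∨ e = q := by
  constructor
  · intro h
    have h' : N.black.SameCycle q e := (Quotient.exact h).symm
    obtain ⟨i, rfl⟩ := h'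
    clear h
    induction i with
    | zero => simp
    | succ i ih =>
      rw [add_comm, zpow_add, zpow_one, Perm.mul_apply]
      rcases ih with h | h | h <;> rw [h] <;> simp [hu, hx, hq]
    | pred i ih =>
      rw [sub_eq_add_neg, add_comm, zpow_add, zpow_neg_one, Perm.mul_apply]
      rcases ih with h | h | h <;> rw [h]
      · rw [← hq]; simp
      · rw [← hu]; simp
      · rw [← hx]; simp
  · rintro (h | h | h) <;> subst h
    · rw [← hq]; exact N.blackEnd_black q
    · rw [← hx]; exact (N.blackEnd_black _).symm
    · rfl

/-- The auxiliary graphs of a move across a rung leave no freedom in the weights.  The last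
contraction rescales exactly the edges `inr true` and `x` at the black endpoint of `q`, by the weight
of `p`. -/
theorem SpiderAcrossRung.exists_isRungWeightChange {F : Type*} [DecidableEq F]
    {G G' : WeightedMap F} {x q r t p s : F} (h : SpiderAcrossRung G G' x q r t p s)
    (hd : [x, q, r, t, p, s].Nodup) :
    ∃ Δ, IsRungWeightChange G.wt G'.wt x q r t p s Δ := by
  simp only [List.nodup_cons, List.mem_cons, List.not_mem_nil, or_false, not_or] at hd
  obtain ⟨G₁, G₂, c₁, ha, hb, sp, c₂⟩ := h
  have h₁ : ∀ e, G₁.wt (Sum.inl e) = G.wt e := by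
    intro e
    by_cases he : G₁.blackEnd (Sum.inl e) = G₁.blackEnd (Sum.inr true)
    · simpa [ha, hb] using (c₁.wt_eq e he).symm
    · exact (c₁.wt_eq_of_ne e he).symm
  obtain ⟨Δ, hΔ, hq, ht, hu, hr, hx, hv⟩ := sp.wt_eq
  have hbe : ∀ e, G₂.blackEnd e = G₂.blackEnd (Sum.inl q) ↔
      e = Sum.inr true ∨ e = Sum.inl x ∨ e = Sum.inl q := fun e =>
    blackEnd_eq_of_threeCycle G₂.toBipartiteMap (by rw [sp.black_eq]; exact sp.black_u)
      (by rw [sp.black_eq]; exact sp.black_x) (by rw [sp.black_eq]; exact sp.black_q)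
  have hp : G₂.wt (Sum.inl p) = G.wt p := by
    rw [← h₁]; apply sp.wt_eq_of_ne; simp; grind
  have hf : G₂.wt (Sum.inr false) = 1 := by
    rw [← hb]; apply sp.wt_eq_of_ne; simp
  have e1 := c₂.wt_eq
  have e2 := c₂.wt_eq_of_ne
  simp only [hbe, ne_eq] at e1 e2
  simp only [h₁] at hΔ hu hr hx hv
  rw [ha, one_mul] at hu hr
  refine ⟨Δ, hΔ, ?_, ?_, ?_, ?_, ?_, ?_, ?_⟩
  · have hx' : relabel q p x = Sum.inl x := by simp [relabel, hd]
    rw [e1 _ (by simp [hx']), hx', hx, hp, hq, div_one, div_mul_eq_mul_div]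
    congr 1; ac_rfl
  · have hx' : relabel q p q = Sum.inr false := by simp [relabel, hd]
    rw [e2 _ (by simp [hx']), hx', hf]
  · have hx' : relabel q p r = Sum.inl r := by grind [relabel]
    rw [e2 _ (by simp [hx']; grind), hx', hr]
  · have hx' : relabel q p t = Sum.inl t := by grind [relabel]
    rw [e2 _ (by simp [hx']; grind), hx', ht]
  · have hx' : relabel q p p = Sum.inr true := by grind [relabel]
    rw [e1 _ (by simp [hx']), hx', hu, hp, hq, div_one, div_mul_eq_mul_div]
    congr 1; ac_rfl
  · have hx' : relabel q p s = Sum.inl s := by grind [relabel]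
    rw [e2 _ (by simp [hx']; grind), hx', hv]
  · intro e he
    simp only [List.mem_cons, List.not_mem_nil, or_false, not_or] at he
    have hx' : relabel q p e = Sum.inl e := by grind [relabel]
    rw [e2 _ (by simp [hx']; grind), hx', ← h₁]
    apply sp.wt_eq_of_ne
    simp; grind

namespace BipartiteMap
variable {E : Type*} {M : BipartiteMap E}

/-! ### The edges of a cyclic chain of hexagons -/

/-- In a minimal graph no zig-zag path passes through an edge in both directions:
two translates of its lift that meet at one edge would meet again one period later. -/
theorem IsMinimal.zigzagOf_ne [Fintype E] [DecidableEq E] (hM : M.IsMinimal) (e : E) :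
    M.zigzagOf (e, true) ≠ M.zigzagOf (e, false) := by
  intro h
  have hs : M.zigzagPerm.SameCycle (e, true) (e, false) := Quotient.exact h
  obtain ⟨a, -, ha⟩ := hs.exists_pow_eq'
  -- A common period of the two oriented edges; over it both run through the same closed path.
  refine hM.2 (e, true) (e, false) (orderOf M.zigzagPerm) (orderOf M.zigzagPerm) rfl (by simp)
    (orderOf_pos _) (orderOf_pos _) (by simp [pow_orderOf_eq_one]) ?_
  have shift : ∀ b : ℕ, M.displacement ((M.zigzagPerm ^ b) (e, true)) (orderOf M.zigzagPerm) =
      M.displacement (e, true) (orderOf M.zigzagPerm) := by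
    intro b
    induction b with
    | zero => simp
    | succ b ih =>
      rw [← ih]
      have h1 := Finset.sum_range_succ
        (fun i => M.stepChain ((M.zigzagPerm ^ (i + b)) (e, true))) (orderOf M.zigzagPerm)
      have h2 := Finset.sum_range_succ'
        (fun i => M.stepChain ((M.zigzagPerm ^ (i + b)) (e, true))) (orderOf M.zigzagPerm)
      rw [h1] at h2
      simp only [pow_add M.zigzagPerm (orderOf M.zigzagPerm), pow_orderOf_eq_one, one_mul,
        zero_add] at h2
      simp only [displacement, ← Perm.mul_apply, ← pow_add]
      rw [add_right_cancel h2]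
      refine Finset.sum_congr rfl fun i _ => ?_
      congr 3
      ring
  rw [← ha, shift, sub_self]
  exact zero_mem _

namespace HexChain
variable {n : ℕ} (H : M.HexChain n)

theorem facePerm_p (k : ZMod n) : M.facePerm (H.p k) = H.s k := by
  rw [facePerm, Perm.mul_apply, Perm.inv_eq_iff_eq, H.black_s, Perm.inv_eq_iff_eq, H.white_r]

theorem facePerm_s (k : ZMod n) : M.facePerm (H.s k) = H.r (k + 1) := by
  rw [facePerm, Perm.mul_apply, Perm.inv_eq_iff_eq, H.black_r, Perm.inv_eq_iff_eq, H.white_t]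

theorem faceOf_s (k : ZMod n) : M.faceOf (H.s k) = M.faceOf (H.p k) :=
  Quotient.sound ⟨-1, by rw [zpow_neg_one, Perm.inv_eq_iff_eq, H.facePerm_p]⟩

theorem faceOf_r (k : ZMod n) : M.faceOf (H.r (k + 1)) = M.faceOf (H.p k) := by
  rw [← H.faceOf_s]
  exact Quotient.sound ⟨-1, by rw [zpow_neg_one, Perm.inv_eq_iff_eq, H.facePerm_s]⟩

theorem p_ne_s (i j : ZMod n) : H.p i ≠ H.s j := by
  intro h
  have := H.distinct i j (by rw [← H.faceOf_s j, h])
  have := H.hexagon i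
  grind

theorem p_ne_r (i j : ZMod n) : H.p i ≠ H.r (j + 1) := by
  intro h
  have := H.distinct i j (by rw [← H.faceOf_r j, h])
  have := H.hexagon i
  grind

theorem s_ne_r (i j : ZMod n) : H.s i ≠ H.r (j + 1) := by
  intro h
  have := H.distinct i j (by rw [← H.faceOf_r j, ← H.faceOf_s i, h])
  have := H.hexagon i
  grind

theorem p_injective : Function.Injective H.p := fun i j h => H.distinct i j (by rw [h])

theorem s_injective : Function.Injective H.s := fun i j h =>
  H.distinct i j (by rw [← H.faceOf_s i, ← H.faceOf_s j, h])

theorem r_injective : Function.Injective H.r := fun i j h => by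
  have := H.distinct (i - 1) (j - 1) (by rw [← H.faceOf_r, ← H.faceOf_r]; simp [h])
  simpa using this

theorem q_injective : Function.Injective H.q := fun i j h =>
  H.p_injective (M.black.injective (by rw [H.black_p, H.black_p, h]))

theorem t_injective : Function.Injective H.t := fun i j h =>
  add_right_cancel (H.r_injective (M.black.injective (by rw [H.black_r, H.black_r, h])))

theorem q_ne_r (i j : ZMod n) : H.q i ≠ H.r j := by
  rw [← H.black_p, ← H.black_s]; exact fun h => H.p_ne_s _ _ (M.black.injective h)

theorem q_ne_t (i j : ZMod n) : H.q i ≠ H.t j := by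
  rw [← H.black_p, ← H.black_r]; exact fun h => H.p_ne_r _ _ (M.black.injective h)

theorem r_ne_t (i j : ZMod n) : H.r i ≠ H.t j := by
  rw [← H.black_s, ← H.black_r]; exact fun h => H.s_ne_r _ _ (M.black.injective h)

theorem zigzagPerm_q (k : ZMod n) : M.zigzagPerm (H.q k, true) = (H.p (k + 1), false) := by
  simp [zigzagPerm, Equiv.symm_apply_eq, H.white_p]

theorem zigzagPerm_p (k : ZMod n) : M.zigzagPerm (H.p k, false) = (H.q k, true) := by
  simp [zigzagPerm, H.black_p]

theorem zigzagPerm_s (k : ZMod n) : M.zigzagPerm (H.s k, true) = (H.t k, false) := by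
  simp [zigzagPerm, Equiv.symm_apply_eq, H.white_t]

theorem zigzagPerm_t (k : ZMod n) : M.zigzagPerm (H.t k, false) = (H.s (k + 1), true) := by
  simp [zigzagPerm, H.black_t]

theorem zigzagOf_zigzagPerm (d : E × Bool) : M.zigzagOf (M.zigzagPerm d) = M.zigzagOf d :=
  Quotient.sound ⟨-1, by simp⟩

theorem zmod_const {α : Type*} [NeZero n] {f : ZMod n → α} (h : ∀ k, f (k + 1) = f k)
    (k : ZMod n) : f k = f 0 := by
  have : ∀ m : ℕ, f m = f 0 := by
    intro m
    induction m with
    | zero => simp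
    | succ m ih => rw [Nat.cast_succ, h, ih]
  rw [← ZMod.natCast_zmod_val k, this]

theorem zigzagOf_p (k : ZMod n) : M.zigzagOf (H.p k, false) = M.zigzagOf (H.q k, true) := by
  rw [← H.zigzagPerm_p, zigzagOf_zigzagPerm]

theorem zigzagOf_t (k : ZMod n) : M.zigzagOf (H.t k, false) = M.zigzagOf (H.s k, true) := by
  rw [← H.zigzagPerm_s, zigzagOf_zigzagPerm]

theorem zigzagOf_q_eq_left [NeZero n] (k : ZMod n) : M.zigzagOf (H.q k, true) = H.left :=
  zmod_const (f := fun k => M.zigzagOf (H.q k, true)) (fun k => by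
    rw [← H.zigzagOf_p, ← H.zigzagPerm_q, zigzagOf_zigzagPerm]) k

theorem zigzagOf_s_eq_right [NeZero n] (k : ZMod n) : M.zigzagOf (H.s k, true) = H.right :=
  zmod_const (f := fun k => M.zigzagOf (H.s k, true)) (fun k => by
    rw [← H.zigzagPerm_t, zigzagOf_zigzagPerm, H.zigzagOf_t]) k

theorem zigzagOf_p_eq_left [NeZero n] (k : ZMod n) : M.zigzagOf (H.p k, false) = H.left := by
  rw [zigzagOf_p, zigzagOf_q_eq_left]

theorem zigzagOf_t_eq_right [NeZero n] (k : ZMod n) : M.zigzagOf (H.t k, false) = H.right := by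
  rw [zigzagOf_t, zigzagOf_s_eq_right]

theorem mem_of_zigzagOf_eq [Finite E] (S : Set (E × Bool)) (hS : ∀ d ∈ S, M.zigzagPerm d ∈ S)
    {d d' : E × Bool} (hd : d ∈ S) (h : M.zigzagOf d' = M.zigzagOf d) : d' ∈ S := by
  cases nonempty_fintype E
  classical
  obtain ⟨a, -, ha⟩ := (Quotient.exact h.symm : M.zigzagPerm.SameCycle d d').exists_pow_eq'
  rw [← ha]
  clear ha
  induction a with
  | zero => simpa
  | succ a ih => rw [pow_succ', Perm.mul_apply]; exact hS _ ih

theorem zigzagOf_eq_left_iff [Finite E] [NeZero n] (e : E) (o : Bool) :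
    M.zigzagOf (e, o) = H.left ↔ ∃ k, (e, o) = (H.q k, true) ∨ (e, o) = (H.p k, false) := by
  constructor
  · intro h
    refine mem_of_zigzagOf_eq {d | ∃ k, d = (H.q k, true) ∨ d = (H.p k, false)} ?_
      ⟨0, Or.inl rfl⟩ h
    rintro d ⟨k, rfl | rfl⟩
    · exact ⟨k + 1, Or.inr (H.zigzagPerm_q k)⟩
    · exact ⟨k, Or.inl (H.zigzagPerm_p k)⟩
  · rintro ⟨k, h | h⟩ <;> rw [h]
    · exact H.zigzagOf_q_eq_left k
    · exact H.zigzagOf_p_eq_left k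

theorem zigzagOf_eq_right_iff [Finite E] [NeZero n] (e : E) (o : Bool) :
    M.zigzagOf (e, o) = H.right ↔ ∃ k, (e, o) = (H.s k, true) ∨ (e, o) = (H.t k, false) := by
  constructor
  · intro h
    refine mem_of_zigzagOf_eq {d | ∃ k, d = (H.s k, true) ∨ d = (H.t k, false)} ?_
      ⟨0, Or.inl rfl⟩ h
    rintro d ⟨k, rfl | rfl⟩
    · exact ⟨k, Or.inr (H.zigzagPerm_s k)⟩
    · exact ⟨k + 1, Or.inl (H.zigzagPerm_t k)⟩
  · rintro ⟨k, h | h⟩ <;> rw [h]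
    · exact H.zigzagOf_s_eq_right k
    · exact H.zigzagOf_t_eq_right k

/-- The five edges whose weights change when the bigon edge moves from `f_k` across the
rung `r (k + 1)` to `f_(k+1)`. -/
def edge (z : ZMod n × Fin 5) : E :=
  ![H.q z.1, H.r (z.1 + 1), H.t z.1, H.p (z.1 + 1), H.s (z.1 + 1)] z.2

/-- A chain is embedded: all the edges at its rungs are distinct.  For edges that are walked in the
same direction around the hexagons this is distinctness of the hexagons; the other coincidences
would be common edges of the two bounding zig-zag paths in the same direction, or
self-intersections of one of them. -/
theorem edge_injective [Fintype E] [DecidableEq E] [NeZero n] (hM : M.IsMinimal)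
    (hH : H.left ≠ H.right) : Function.Injective H.edge := by
  have hqs : ∀ i j, H.q i ≠ H.s j := fun i j h => hH (by
    rw [← H.zigzagOf_q_eq_left i, h, H.zigzagOf_s_eq_right])
  have hpt : ∀ i j, H.p i ≠ H.t j := fun i j h => hH (by
    rw [← H.zigzagOf_p_eq_left i, h, H.zigzagOf_t_eq_right])
  have hqp : ∀ i j, H.q i ≠ H.p j := fun i j h => hM.zigzagOf_ne (H.q i) (by
    rw [H.zigzagOf_q_eq_left i, h, H.zigzagOf_p_eq_left])
  have hst : ∀ i j, H.s i ≠ H.t j := fun i j h => hM.zigzagOf_ne (H.s i) (by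
    rw [H.zigzagOf_s_eq_right i, h, H.zigzagOf_t_eq_right])
  rintro ⟨i, a⟩ ⟨j, b⟩ h
  fin_cases a <;> fin_cases b <;>
    simp [edge, H.q_injective.eq_iff, H.r_injective.eq_iff, H.t_injective.eq_iff,
      H.p_injective.eq_iff, H.s_injective.eq_iff, H.p_ne_s, H.p_ne_r, H.s_ne_r, H.q_ne_r,
      H.q_ne_t, H.r_ne_t, hqs, hpt, hqp, hst, (H.p_ne_s _ _).symm, (H.p_ne_r _ _).symm,
      (H.s_ne_r _ _).symm, (H.q_ne_r _ _).symm, (H.q_ne_t _ _).symm, (H.r_ne_t _ _).symm,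
      (hqs _ _).symm, (hpt _ _).symm, (hqp _ _).symm, (hst _ _).symm] at h ⊢ <;> exact h

end HexChain
end BipartiteMap

/-! ### Moving an edge across a rung -/

section
variable {F : Type*} [DecidableEq F]

/-- The rotation at the black vertices after the uncontraction: the edges `x`, `q` of a vertex
with rotation `σ` are split off to a vertex of their own with the new edge `inr true`, and the new
edge `inr false` takes their place. -/
def splitOff (σ : Perm F) (x q : F) : Perm (F ⊕ Bool) :=
  swap (Sum.inr true) (Sum.inl x) * swap (Sum.inl x) (Sum.inr false) *
    swap (Sum.inr false) (Sum.inl (σ q)) * Perm.sumCongr (insertBefore x q σ) 1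

/-- The rotation at the white vertices after the uncontraction: the new edges `inr false` and
`inr true` share a two-valent white vertex. -/
def addTwoValent (τ : Perm F) : Perm (F ⊕ Bool) :=
  Perm.sumCongr τ (swap false true)

theorem splitOff_apply (σ : Perm F) (x q : F) (hx : σ x = x) (hxq : x ≠ q) (hq : σ q ≠ q)
    (z : F ⊕ Bool) : splitOff σ x q z =
      z.elim (fun e => if e = x then Sum.inl q else if e = q then Sum.inr true else
        if σ e = q then Sum.inr false else Sum.inl (σ e))
      (fun i => if i then Sum.inl x else Sum.inl (σ q)) := by
  have h1 : σ q ≠ x := fun h => hxq (σ.injective (by rw [h, hx]))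
  rcases z with e | i
  · simp only [splitOff, Perm.mul_apply, Perm.sumCongr_apply, Sum.map_inl, insertBefore_apply hx,
      Sum.elim_inl]
    by_cases h2 : e = x
    · subst h2
      simp [swap_apply_def, hxq.symm, hq.symm]
    by_cases h3 : e = q
    · subst h3
      simp [h2, hq]
    have h4 : σ e ≠ σ q := fun h => h3 (σ.injective h)
    have h5 : σ e ≠ x := fun h => h2 (σ.injective (by rw [h, hx]))
    by_cases h6 : σ e = q <;> simp [swap_apply_def, h1.symm, h2, h3, h4, h5, h6]
  · cases i <;> simp [splitOff, swap_apply_def, h1]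

/-- The construction of a move across a rung: `x` is inserted into a graph with rotations `σ`, `τ`
next to the rung `r`, once below it (before `q` and after `t`) and once above it (after `p` and
before `s`). -/
theorem spiderAcrossRung_of_isRungWeightChange (σ τ : Perm F) (w w' : F → ℂˣ)
    {x q r t p s : F} (hd : [x, q, r, t, p, s].Nodup) (hσx : σ x = x) (hτx : τ x = x)
    (hτq : τ q = r) (hτr : τ r = p) (hτp : τ p = q) (hσr : σ r = t) (hσt : σ t = s)
    (hσs : σ s = r) (hσq : σ q ≠ q) (hσp : σ p ≠ p) {Δ : ℂˣ}
    (hw : IsRungWeightChange w w' x q r t p s Δ) :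
    SpiderAcrossRung ⟨⟨insertBefore x q σ, insertBefore x (τ t) τ⟩, w⟩
      ⟨⟨insertBefore x (σ p) σ, insertBefore x s τ⟩, w'⟩ x q r t p s := by
  simp only [List.nodup_cons, List.mem_cons, List.not_mem_nil, or_false, not_or] at hd
  obtain ⟨⟨xq, xr, xt, xp, xs⟩, ⟨qr, qt, qp, qs⟩, ⟨rt, rp, rs⟩, ⟨tp, ts⟩, ps, -⟩ := hd
  have hB := splitOff_apply σ x q hσx xq hσq
  have hW : ∀ z, addTwoValent (insertBefore x (τ t) τ) z =
      z.elim (fun e => Sum.inl (if e = x then τ t else if τ e = τ t then x else τ e))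
        (fun i => Sum.inr (!i)) := by
    rintro (e | i)
    · simp [addTwoValent, insertBefore_apply hτx]
    · cases i <;> simp [addTwoValent]
  have hσi := fun a b => σ.injective.eq_iff (a := a) (b := b)
  have hτi := fun a b => τ.injective.eq_iff (a := a) (b := b)
  -- The white rotation after the spider move: `r` has moved to the vertex of the new edges, `x`
  -- stands before `s`, and `q`, `p` have become two-valent.
  have hW₂ : ∀ z, insertBefore (Sum.inl x) (Sum.inl s) (insertBefore (Sum.inl r) (Sum.inr true)
      (TorusDimer.erase (Sum.inl x) (TorusDimer.erase (Sum.inl r)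
        (addTwoValent (insertBefore x (τ t) τ))))) z =
      z.elim (fun e => if e = x then Sum.inl s else if e = r then Sum.inr true else
        if e = q then Sum.inl p else if τ e = s then Sum.inl x else Sum.inl (τ e))
        (fun i => if i then Sum.inr false else Sum.inl r) := by
    have f1 : ∀ z, TorusDimer.erase (Sum.inl r) (addTwoValent (insertBefore x (τ t) τ)) z =
        z.elim (fun e => if e = r then Sum.inl r else if e = q then Sum.inl p else
          Sum.inl (if e = x then τ t else if τ e = τ t then x else τ e))
          (fun i => Sum.inr (!i)) := by
      intro z
      rw [erase_apply, hW, hW]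
      rcases z with e | i
      · simp only [Sum.elim_inl, Sum.inl.injEq]
        grind
      · simp
    have f2 : ∀ z, TorusDimer.erase (Sum.inl x) (TorusDimer.erase (Sum.inl r)
          (addTwoValent (insertBefore x (τ t) τ))) z =
        z.elim (fun e => if e = r then Sum.inl r else if e = q then Sum.inl p else Sum.inl (τ e))
          (fun i => Sum.inr (!i)) := by
      intro z
      rw [erase_apply, f1, f1]
      rcases z with e | i
      · simp only [Sum.elim_inl, Sum.inl.injEq]
        grind
      · simp
    have f3 : ∀ z, insertBefore (Sum.inl r) (Sum.inr true) (TorusDimer.erase (Sum.inl x)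
          (TorusDimer.erase (Sum.inl r) (addTwoValent (insertBefore x (τ t) τ)))) z =
        z.elim (fun e => if e = r then Sum.inr true else
          if e = q then Sum.inl p else Sum.inl (τ e))
          (fun i => if i then Sum.inr false else Sum.inl r) := by
      intro z
      rw [insertBefore_apply (by simp [f2]), f2]
      rcases z with e | i
      · simp only [Sum.elim_inl, Sum.inl.injEq]
        grind
      · cases i <;> simp
    intro z
    rw [insertBefore_apply (by simp [f3, hτx, xr, xq]), f3]
    rcases z with e | i
    · simp only [Sum.elim_inl, Sum.inl.injEq]
      grind
    · cases i <;> simp [rs]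
  refine ⟨⟨⟨splitOff σ x q, addTwoValent (insertBefore x (τ t) τ)⟩, Sum.elim w 1⟩,
    ⟨⟨splitOff σ x q, insertBefore (Sum.inl x) (Sum.inl s) (insertBefore (Sum.inl r) (Sum.inr true)
      (TorusDimer.erase (Sum.inl x) (TorusDimer.erase (Sum.inl r)
        (addTwoValent (insertBefore x (τ t) τ)))))⟩,
      fun e => if e = Sum.inr true then w t / Δ else if e = Sum.inl r then w r / Δ else
        if e = Sum.inl x then w s * w x / Δ else if e = Sum.inl s then w s * w q / Δ else
        if e = Sum.inl q then 1 else if e = Sum.inl t then 1 else Sum.elim w 1 e⟩, ?_, rfl, rfl,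
    ?_, ?_⟩
  -- Contracting the vertex of the two new edges gives back the graph with `x` before `q`.
  · constructor
    · exact Sum.inl_injective
    · rintro (e | i) <;> simp
    · simp
    · simp [hW]
    · simp [hW]
    · intro h
      have h3 := fun e => (blackEnd_eq_of_threeCycle (e := e)
        ⟨splitOff σ x q, addTwoValent (insertBefore x (τ t) τ)⟩ (u := Sum.inr true) (x := Sum.inl x)
        (q := Sum.inl q) (by simp [hB]) (by simp [hB]) (by simp [hB, Ne.symm xq]))
      have h4 := (h3 (Sum.inr false)).1 (by rw [← h, h3]; simp)
      simp at h4
    · simp [hB]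
    · simp [hB]
    · intro e
      simp [hW, insertBefore_apply hτx]
    · intro e
      simp only [hB, insertBefore_apply hσx, Sum.elim_inl, Sum.elim_inr]
      grind
    · intro e
      simp only [hB, insertBefore_apply hσx, Sum.elim_inl, Sum.elim_inr]
      grind
    · intro e
      simp only [hB, insertBefore_apply hσx, Sum.elim_inl]
      grind
    · intro e _
      simp
    · intro e _
      simp
  -- The spider move at the square with sides `x`, `q`, `r`, `t`.
  · constructor
    · simp; grind
    · simp [hB]
    · simp [hB]
    · simp [hB, Ne.symm xq]
    · simp [hB]; grind
    · simp [hB]; grind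
    · simp [hB]; grind
    · simp [hW]; grind
    · simp [hW]; grind
    · rfl
    · rfl
    · simp; grind
    · refine ⟨Δ, hw.delta, ?_⟩
      simp; grind
  -- Contracting `q`, `p`; the two new edges take over their labels.
  · have hR : ∀ e, relabel q p e = if e = p then Sum.inr true else if e = q then Sum.inr false
      else Sum.inl e := fun e => rfl
    have h3 := fun e => (blackEnd_eq_of_threeCycle (e := e)
        ⟨splitOff σ x q, insertBefore (Sum.inl x) (Sum.inl s) (insertBefore (Sum.inl r)
          (Sum.inr true) (TorusDimer.erase (Sum.inl x) (TorusDimer.erase (Sum.inl r)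
            (addTwoValent (insertBefore x (τ t) τ)))))⟩ (u := Sum.inr true) (x := Sum.inl x)
        (q := Sum.inl q) (by simp [hB]) (by simp [hB]) (by simp [hB, Ne.symm xq]))
    constructor
    · intro e e'
      simp only [hR]
      grind
    · rintro (e | i)
      · constructor
        · rintro ⟨e', he'⟩
          rw [hR] at he'
          grind
        · intro h
          simp only [ne_eq, Sum.inl.injEq] at h
          exact ⟨e, by simp [hR, h]⟩
      · cases i
        · simpa using ⟨q, by simp [hR, qp]⟩
        · simpa using ⟨p, by simp [hR]⟩
    · simp [qp]
    · simp [hW₂, Ne.symm xq, qr]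
    · simp [hW₂]; grind
    · intro h
      have h4 := (h3 _).1 h.symm
      simp at h4
      grind
    · simp [hB]; grind
    · simp [hB]; grind
    · intro e
      have := hτi e q
      have := hτi e p
      have := hτi e r
      have := hτi e x
      have := hτi e t
      simp only [hR, hW₂, insertBefore_apply hτx]
      by_cases h1 : e = p
      · grind
      by_cases h2 : e = q
      · grind
      simp only [h1, h2, if_false, Sum.elim_inl]
      grind
    · intro e
      have := hσi e q
      have := hσi e p
      have := hσi e x
      have := hσi p q
      have := hσi p x
      simp only [hR, hB, insertBefore_apply hσx]
      by_cases h1 : e = p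
      · grind
      by_cases h2 : e = q
      · grind
      simp only [h1, h2, if_false, Sum.elim_inl]
      grind
    · intro e
      have := hσi e q
      have := hσi e p
      have := hσi e x
      have := hσi p q
      have := hσi p x
      simp only [hR, hB, insertBefore_apply hσx]
      by_cases h1 : e = p
      · grind
      by_cases h2 : e = q
      · grind
      simp only [h1, h2, if_false, Sum.elim_inl]
      grind
    · intro e
      have := hσi e q
      have := hσi e p
      have := hσi e x
      have := hσi p q
      have := hσi p x
      simp only [hR, hB, insertBefore_apply hσx]
      by_cases h1 : e = p
      · grind
      by_cases h2 : e = q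
      · grind
      simp only [h1, h2, if_false, Sum.elim_inl]
      grind
    · intro e he
      rw [h3, hR] at he
      have h5 : e = p ∨ e = x := by grind
      rcases h5 with h5 | h5 <;> rw [h5]
      · simp only [hR, hw.wt_p, if_true]
        simp [qr, Ne.symm qp, Ne.symm xq, Ne.symm xp, Ne.symm rp, Ne.symm tp, qs, ps,
          div_mul_eq_mul_div]
        simp [mul_comm]
      · simp only [hR, hw.wt_x]
        simp [xp, xq, xr, qr, qs, Ne.symm xq, Ne.symm xp, Ne.symm rp, Ne.symm qp, Ne.symm tp,
          ps, div_mul_eq_mul_div]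
        simp [mul_comm, mul_left_comm]
    · intro e he
      rw [Ne, h3, hR] at he
      simp only [hR]
      have hn := hw.wt_of_ne e
      have := hw.wt_q
      have := hw.wt_r
      have := hw.wt_t
      have := hw.wt_s
      simp only [List.mem_cons, List.not_mem_nil, or_false, not_or] at hn
      have h1 : e ≠ p := by grind
      have h2 : e ≠ x := by grind
      by_cases h3 : e = q
      · simp [h3, qp, hw.wt_q]
      simp only [h1, h3, if_false, reduceCtorEq, Sum.inl.injEq, Sum.elim_inl]
      grind

end

namespace BipartiteMap
variable {E : Type*} {M : BipartiteMap E}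
namespace HexChain
variable {n : ℕ} (H : M.HexChain n)

/-! ### The weights after a full turn -/

theorem prod_range_eq_prod_zmod {A : Type*} [CommMonoid A] [NeZero n] (k : ZMod n)
    (f : ZMod n → A) : ∏ i ∈ Finset.range n, f (k + i) = ∏ z, f z := by
  refine Finset.prod_nbij' (fun i => k + i) (fun z => (z - k).val) ?_ ?_ ?_ ?_ ?_
  · simp
  · intro z _
    simpa using ZMod.val_lt (z - k)
  · intro i hi
    simpa using ZMod.val_cast_of_lt (Finset.mem_range.1 hi)
  · simp
  · simp

theorem natCast_inj {k : ZMod n} {i j : ℕ} (hi : i < n) (hj : j < n) (h : k + (i : ZMod n) = k + j) :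
    i = j := by
  have := congrArg ZMod.val (add_left_cancel h)
  rwa [ZMod.val_cast_of_lt hi, ZMod.val_cast_of_lt hj] at this

theorem nodup_rung {H : M.HexChain n} (hinj : Function.Injective H.edge) (z : ZMod n) :
    [(Sum.inr true : E ⊕ Bool), Sum.inl (H.q z), Sum.inl (H.r (z + 1)), Sum.inl (H.t z),
      Sum.inl (H.p (z + 1)), Sum.inl (H.s (z + 1))].Nodup := by
  have h : ([(z, 0), (z, 1), (z, 2), (z, 3), (z, 4)].map H.edge).Nodup :=
    List.Nodup.map hinj (by simp)
  simpa [edge] using h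

/-- The weights `w j` of the successive graphs of a geometric R-matrix transformation based at
`f_k`, with the denominators `D j` of the spider moves. -/
def IsWeightSequence [NeZero n] (k : ZMod n) (w : ℕ → E ⊕ Bool → ℂˣ) (D : ℕ → ℂˣ) : Prop :=
  ∀ j < n, IsRungWeightChange (w j) (w (j + 1)) (Sum.inr true) (Sum.inl (H.q (k + j)))
    (Sum.inl (H.r (k + j + 1))) (Sum.inl (H.t (k + j))) (Sum.inl (H.p (k + j + 1)))
    (Sum.inl (H.s (k + j + 1))) (D j)

variable {H} [NeZero n] {k : ZMod n} {w : ℕ → E ⊕ Bool → ℂˣ} {D : ℕ → ℂˣ}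

theorem IsWeightSequence.wt_eq_of_forall_ne (hw : H.IsWeightSequence k w D) {e : E} {a b : ℕ}
    (hab : a ≤ b) (hb : b ≤ n) (he : ∀ j, a ≤ j → j < b → ∀ c, e ≠ H.edge (k + j, c)) :
    w b (Sum.inl e) = w a (Sum.inl e) := by
  induction b, hab using Nat.le_induction with
  | base => rfl
  | succ b hab ih =>
    rw [← ih (by lia) (fun j h1 h2 => he j h1 (by lia))]
    refine (hw b (by lia)).wt_of_ne _ ?_
    have h := he b hab (by lia)
    have h0 := h 0
    have h1 := h 1
    have h2 := h 2
    have h3 := h 3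
    have h4 := h 4
    simp only [edge] at h0 h1 h2 h3 h4
    simp_all

theorem IsWeightSequence.wt_before (hw : H.IsWeightSequence k w D)
    (hinj : Function.Injective H.edge) {i : ℕ} (hi : i < n) (c : Fin 5) :
    w i (Sum.inl (H.edge (k + i, c))) = w 0 (Sum.inl (H.edge (k + i, c))) := by
  refine hw.wt_eq_of_forall_ne (Nat.zero_le _) hi.le fun j _ hj c' h => ?_
  have := natCast_inj hi (by lia) (Prod.ext_iff.1 (hinj h)).1
  lia

theorem IsWeightSequence.wt_after (hw : H.IsWeightSequence k w D)
    (hinj : Function.Injective H.edge) {i : ℕ} (hi : i < n) (c : Fin 5) :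
    w n (Sum.inl (H.edge (k + i, c))) = w (i + 1) (Sum.inl (H.edge (k + i, c))) := by
  refine hw.wt_eq_of_forall_ne hi le_rfl fun j h1 hj c' h => ?_
  have := natCast_inj hi (by lia) (Prod.ext_iff.1 (hinj h)).1
  lia

/-- How a geometric R-matrix transformation changes the weights of the edges, in terms of the
denominators `Δ z` of the spider moves across the rungs `r (z + 1)`. -/
structure IsTurnWeightChange (H : M.HexChain n) (wt wt' : E → ℂˣ) (Δ : ZMod n → ℂˣ) : Prop where
  wt_q : ∀ z, wt' (H.q z) = 1
  wt_t : ∀ z, wt' (H.t z) = 1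
  wt_r : ∀ z, wt' (H.r (z + 1)) = wt (H.r (z + 1)) / Δ z
  wt_p : ∀ z, wt' (H.p (z + 1)) = wt (H.p (z + 1)) * wt (H.t z) / Δ z
  wt_s : ∀ z, wt' (H.s (z + 1)) = wt (H.s (z + 1)) * wt (H.q z) / Δ z
  wt_of_notMem : ∀ e, e ∉ Set.range H.edge → wt' e = wt e
  prod_delta : ∏ z, Δ z = ∏ z, wt (H.s (z + 1)) * wt (H.p (z + 1))

/-- The product of the denominators is determined by the requirement that the bigon edge returns
with its original weight. -/
theorem IsWeightSequence.isTurnWeightChange (hw : H.IsWeightSequence k w D)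
    (hinj : Function.Injective H.edge) (hx : w n (Sum.inr true) = w 0 (Sum.inr true)) :
    IsTurnWeightChange H (fun e => w 0 (Sum.inl e)) (fun e => w n (Sum.inl e))
      (fun z => D (z - k).val) := by
  have hz : ∀ P : ZMod n → ℕ → Prop, (∀ i < n, P (k + i) i) → ∀ z, P z (z - k).val := by
    intro P h z
    simpa using h (z - k).val (ZMod.val_lt _)
  have hb : ∀ i < n, ∀ c, w i (Sum.inl (H.edge (k + i, c))) = w 0 (Sum.inl (H.edge (k + i, c))) :=
    fun i hi => hw.wt_before hinj hi
  have ha : ∀ i < n, ∀ c,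
      w n (Sum.inl (H.edge (k + i, c))) = w (i + 1) (Sum.inl (H.edge (k + i, c))) :=
    fun i hi => hw.wt_after hinj hi
  simp only [edge] at ha hb
  constructor
  · exact hz (fun z _ => w n (Sum.inl (H.q z)) = 1) fun i hi =>
      (ha i hi 0).trans (hw i hi).wt_q
  · exact hz (fun z _ => w n (Sum.inl (H.t z)) = 1) fun i hi =>
      (ha i hi 2).trans (hw i hi).wt_t
  · refine hz (fun z i => w n (Sum.inl (H.r (z + 1))) = w 0 (Sum.inl (H.r (z + 1))) / D i)
      fun i hi => ((ha i hi 1).trans (hw i hi).wt_r).trans ?_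
    exact congrArg (· / D i) (hb i hi 1)
  · refine hz (fun z i => w n (Sum.inl (H.p (z + 1))) =
      w 0 (Sum.inl (H.p (z + 1))) * w 0 (Sum.inl (H.t z)) / D i)
      fun i hi => ((ha i hi 3).trans (hw i hi).wt_p).trans ?_
    exact congrArg₂ (· * · / D i) (hb i hi 3) (hb i hi 2)
  · refine hz (fun z i => w n (Sum.inl (H.s (z + 1))) =
      w 0 (Sum.inl (H.s (z + 1))) * w 0 (Sum.inl (H.q z)) / D i)
      fun i hi => ((ha i hi 4).trans (hw i hi).wt_s).trans ?_
    exact congrArg₂ (· * · / D i) (hb i hi 4) (hb i hi 0)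
  · intro e he
    exact hw.wt_eq_of_forall_ne (Nat.zero_le _) le_rfl fun j _ _ c h => he ⟨_, h.symm⟩
  · rw [← prod_range_eq_prod_zmod k, ← prod_range_eq_prod_zmod k]
    have h1 : ∀ i < n, w 0 (Sum.inl (H.s (k + i + 1))) * w 0 (Sum.inl (H.p (k + i + 1))) /
        D i = w (i + 1) (Sum.inr true) / w i (Sum.inr true) := by
      intro i hi
      rw [(hw i hi).wt_x, show w i (Sum.inl (H.s (k + i + 1))) = _ from hb i hi 4,
        show w i (Sum.inl (H.p (k + i + 1))) = _ from hb i hi 3]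
      rw [mul_div_right_comm _ (w i _), mul_div_cancel_right]
      rfl
    have h2 : ∏ i ∈ Finset.range n, w 0 (Sum.inl (H.s (k + i + 1))) *
        w 0 (Sum.inl (H.p (k + i + 1))) / D i = 1 := by
      rw [Finset.prod_congr rfl fun i hi => h1 i (Finset.mem_range.1 hi), Finset.prod_range_div
        (fun i => w i (Sum.inr true)), hx, div_self']
    rw [Finset.prod_div_distrib, div_eq_one] at h2
    rw [h2]
    refine Finset.prod_congr rfl fun i hi => ?_
    rw [add_sub_cancel_left, ZMod.val_cast_of_lt (Finset.mem_range.1 hi)]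

open scoped Classical in
/-- The zig-zag paths at a rung: besides the two paths that bound the chain there are the one that
walks along the rung from black to white, which also passes through `q` and `s`, and the one that
walks along it from white to black, which also passes through `p` and `t`. -/
theorem zigzagChain_edge (H : M.HexChain n) (α : M.Zigzag) (z : ZMod n) :
    ∃ L R A B : ℤ, L = (if H.left = α then 1 else 0) ∧ R = (if H.right = α then 1 else 0) ∧
      A = (if M.zigzagOf (H.r (z + 1), true) = α then 1 else 0) ∧
      B = (if M.zigzagOf (H.r (z + 1), false) = α then 1 else 0) ∧
      M.zigzagChain α (H.q z) = L - A ∧ M.zigzagChain α (H.r (z + 1)) = A - B ∧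
      M.zigzagChain α (H.t z) = B - R ∧ M.zigzagChain α (H.p (z + 1)) = B - L ∧
      M.zigzagChain α (H.s (z + 1)) = R - A := by
  have hq : M.zigzagOf (H.q z, false) = M.zigzagOf (H.r (z + 1), true) := by
    rw [← zigzagOf_zigzagPerm (H.r (z + 1), true)]
    simp [zigzagPerm, ← H.white_q]
  have hs : M.zigzagOf (H.s (z + 1), false) = M.zigzagOf (H.r (z + 1), true) := by
    rw [← zigzagOf_zigzagPerm (H.s (z + 1), false)]
    simp [zigzagPerm, H.black_s]
  have ht : M.zigzagOf (H.t z, true) = M.zigzagOf (H.r (z + 1), false) := by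
    rw [← zigzagOf_zigzagPerm (H.r (z + 1), false)]
    simp [zigzagPerm, H.black_r]
  have hp : M.zigzagOf (H.p (z + 1), true) = M.zigzagOf (H.r (z + 1), false) := by
    rw [← zigzagOf_zigzagPerm (H.p (z + 1), true)]
    simp [zigzagPerm, ← H.white_r]
  refine ⟨_, _, _, _, rfl, rfl, rfl, rfl, ?_, ?_, ?_, ?_, ?_⟩ <;>
    simp only [zigzagChain, hq, hs, ht, hp, zigzagOf_q_eq_left, zigzagOf_p_eq_left,
      zigzagOf_s_eq_right, zigzagOf_t_eq_right]

variable [Fintype E]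

open scoped Classical in
theorem prod_zpow_zigzagChain_eq_prod_edge (hinj : Function.Injective H.edge) (α : M.Zigzag)
    (u : E → ℂˣ) (hu : ∀ e, e ∉ Set.range H.edge → u e ^ M.zigzagChain α e = 1) :
    ∏ e, u e ^ M.zigzagChain α e =
      ∏ z, (u (H.q z) ^ M.zigzagChain α (H.q z) *
        u (H.r (z + 1)) ^ M.zigzagChain α (H.r (z + 1)) * u (H.t z) ^ M.zigzagChain α (H.t z) *
        u (H.p (z + 1)) ^ M.zigzagChain α (H.p (z + 1)) *
        u (H.s (z + 1)) ^ M.zigzagChain α (H.s (z + 1))) := by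
  rw [← Fintype.prod_of_injective H.edge hinj
    (fun z => u (H.edge z) ^ M.zigzagChain α (H.edge z)) _ hu (fun _ => rfl),
    Fintype.prod_prod_type]
  refine Finset.prod_congr rfl fun z _ => ?_
  rw [Fin.prod_univ_five]
  rfl

theorem C_toX (α : M.Zigzag) (wt : E → ℂˣ) :
    M.C α (M.toX wt) = ∏ e, wt e ^ M.zigzagChain α e := rfl

theorem zigzagOf_r_ne_left (H : M.HexChain n) (z : ZMod n) (o : Bool) :
    M.zigzagOf (H.r (z + 1), o) ≠ H.left := by
  rw [Ne, zigzagOf_eq_left_iff]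
  rintro ⟨k, h | h⟩
  · exact H.q_ne_r _ _ (Prod.ext_iff.1 h).1.symm
  · exact H.p_ne_r _ _ (Prod.ext_iff.1 h).1.symm

theorem zigzagOf_r_ne_right (H : M.HexChain n) (z : ZMod n) (o : Bool) :
    M.zigzagOf (H.r (z + 1), o) ≠ H.right := by
  rw [Ne, zigzagOf_eq_right_iff]
  rintro ⟨k, h | h⟩
  · exact H.s_ne_r _ _ (Prod.ext_iff.1 h).1.symm
  · exact H.r_ne_t _ _ (Prod.ext_iff.1 h).1

/-- The path `left` walks along no other edges than `q` and `p`; in particular it contains no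
rung. -/
theorem C_left_toX (hinj : Function.Injective H.edge) (hH : H.left ≠ H.right) (wt : E → ℂˣ) :
    M.C H.left (M.toX wt) = ∏ z, wt (H.q z) / wt (H.p (z + 1)) := by
  rw [C_toX, prod_zpow_zigzagChain_eq_prod_edge hinj]
  · refine Finset.prod_congr rfl fun z _ => ?_
    obtain ⟨L, R, A, B, hL, hR, hA, hB, h0, h1, h2, h3, h4⟩ := H.zigzagChain_edge H.left z
    rw [if_pos rfl] at hL
    rw [if_neg hH.symm] at hR
    rw [if_neg (H.zigzagOf_r_ne_left z _)] at hA hB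
    subst hL hR hA hB
    rw [h0, h1, h2, h3, h4]
    simp [div_eq_mul_inv]
  · intro e he
    have h : ∀ o, M.zigzagOf (e, o) ≠ H.left := by
      intro o
      rw [Ne, zigzagOf_eq_left_iff]
      rintro ⟨k, h | h⟩
      · exact he ⟨(k, 0), (Prod.ext_iff.1 h).1.symm⟩
      · refine he ⟨(k - 1, 3), ?_⟩
        simpa [edge] using (Prod.ext_iff.1 h).1.symm
    simp [zigzagChain, h]

theorem C_right_toX (hinj : Function.Injective H.edge) (hH : H.left ≠ H.right) (wt : E → ℂˣ) :
    M.C H.right (M.toX wt) = ∏ z, wt (H.s (z + 1)) / wt (H.t z) := by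
  rw [C_toX, prod_zpow_zigzagChain_eq_prod_edge hinj]
  · refine Finset.prod_congr rfl fun z _ => ?_
    obtain ⟨L, R, A, B, hL, hR, hA, hB, h0, h1, h2, h3, h4⟩ := H.zigzagChain_edge H.right z
    rw [if_neg hH] at hL
    rw [if_pos rfl] at hR
    rw [if_neg (H.zigzagOf_r_ne_right z _)] at hA hB
    subst hL hR hA hB
    rw [h0, h1, h2, h3, h4]
    simp [div_eq_mul_inv, mul_comm]
  · intro e he
    have h : ∀ o, M.zigzagOf (e, o) ≠ H.right := by
      intro o
      rw [Ne, zigzagOf_eq_right_iff]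
      rintro ⟨k, h | h⟩
      · refine he ⟨(k - 1, 4), ?_⟩
        simpa [edge] using (Prod.ext_iff.1 h).1.symm
      · exact he ⟨(k, 2), (Prod.ext_iff.1 h).1.symm⟩
    simp [zigzagChain, h]

open scoped Classical in
/-- The factors at the zig-zag paths that cross the chain at a rung cancel; only the paths that
bound the chain see the change of the weights. -/
theorem IsTurnWeightChange.C_toX {wt wt' : E → ℂˣ} {Δ : ZMod n → ℂˣ}
    (h : IsTurnWeightChange H wt wt' Δ) (hinj : Function.Injective H.edge) (α : M.Zigzag) :
    M.C α (M.toX wt') = M.C α (M.toX wt) *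
      (∏ z, (wt (H.s (z + 1)) * wt (H.p (z + 1)) / (wt (H.q z) * wt (H.t z)))) ^
        ((if H.left = α then 1 else 0) - (if H.right = α then 1 else 0) : ℤ) := by
  rw [← div_eq_iff_eq_mul', HexChain.C_toX, HexChain.C_toX, ← Finset.prod_div_distrib]
  simp only [← div_zpow]
  rw [prod_zpow_zigzagChain_eq_prod_edge hinj α (fun e => wt' e / wt e)
    (fun e he => by simp [h.wt_of_notMem e he]), Finset.prod_div_distrib, ← h.prod_delta,
    ← Finset.prod_div_distrib, ← Finset.prod_zpow]
  refine Finset.prod_congr rfl fun z _ => ?_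
  obtain ⟨L, R, A, B, hL, hR, -, -, h0, h1, h2, h3, h4⟩ := H.zigzagChain_edge α z
  rw [← hL, ← hR, h0, h1, h2, h3, h4, h.wt_q, h.wt_r, h.wt_t, h.wt_p, h.wt_s]
  simp only [one_div, div_zpow, mul_zpow, inv_zpow, zpow_sub]
  ext
  push_cast
  field_simp

end HexChain
end BipartiteMap

/-! ### Solving for the weight of the bigon -/

section
variable {A : Type*} [CommRing A]

/-- The composition of the Möbius maps `x ↦ a i * x / (c i * x + b i)` for `i < j` is
`x ↦ (∏ a) * x / (R * x + ∏ b)`, where `R` is `moebiusCoeff a b c j`. -/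
def moebiusCoeff (a b c : ℕ → A) : ℕ → A
  | 0 => 0
  | j + 1 => c j * ∏ i ∈ Finset.range j, a i + b j * moebiusCoeff a b c j

/-- The denominator of the composition of the first `j` Möbius maps at the fixed point of the
composition of all `n` of them, cleared of fractions. -/
def fixedPointDenom (n : ℕ) (a b c : ℕ → A) (j : ℕ) : A :=
  moebiusCoeff a b c j * (∏ i ∈ Finset.range n, a i - ∏ i ∈ Finset.range n, b i) +
    (∏ i ∈ Finset.range j, b i) * moebiusCoeff a b c n

theorem fixedPointDenom_succ (n : ℕ) (a b c : ℕ → A) (j : ℕ) :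
    fixedPointDenom n a b c (j + 1) = c j * (∏ i ∈ Finset.range j, a i) *
      (∏ i ∈ Finset.range n, a i - ∏ i ∈ Finset.range n, b i) + b j * fixedPointDenom n a b c j := by
  rw [fixedPointDenom, fixedPointDenom, Finset.prod_range_succ, moebiusCoeff]
  ring

theorem fixedPointDenom_self (n : ℕ) (a b c : ℕ → A) :
    fixedPointDenom n a b c n =
      (∏ i ∈ Finset.range n, a i) * fixedPointDenom n a b c 0 := by
  simp only [fixedPointDenom, moebiusCoeff, Finset.prod_range_zero]
  ring

theorem map_moebiusCoeff {B : Type*} [CommRing B] (f : A →+* B) (a b c : ℕ → A) (j : ℕ) :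
    f (moebiusCoeff a b c j) =
      moebiusCoeff (fun i => f (a i)) (fun i => f (b i)) (fun i => f (c i)) j := by
  induction j with
  | zero => simp [moebiusCoeff]
  | succ j ih => simp [moebiusCoeff, ih]

theorem map_fixedPointDenom {B : Type*} [CommRing B] (f : A →+* B) (n : ℕ) (a b c : ℕ → A)
    (j : ℕ) : f (fixedPointDenom n a b c j) =
      fixedPointDenom n (fun i => f (a i)) (fun i => f (b i)) (fun i => f (c i)) j := by
  simp [fixedPointDenom, map_moebiusCoeff]

end

theorem moebiusCoeff_pos {j : ℕ} (hj : 0 < j) :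
    0 < moebiusCoeff (fun _ => (2 : ℝ)) (fun _ => 1) (fun _ => 1) j := by
  induction j, hj using Nat.le_induction with
  | base => simp [moebiusCoeff]
  | succ j _ ih => simp only [moebiusCoeff]; positivity

theorem fixedPointDenom_pos {n : ℕ} (hn : 0 < n) (j : ℕ) :
    0 < fixedPointDenom n (fun _ => (2 : ℝ)) (fun _ => 1) (fun _ => 1) j := by
  have h1 : (1 : ℝ) ≤ 2 ^ n := one_le_pow₀ (by norm_num)
  have h2 := moebiusCoeff_pos hn
  have h3 : 0 ≤ moebiusCoeff (fun _ => (2 : ℝ)) (fun _ => 1) (fun _ => 1) j := by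
    rcases Nat.eq_zero_or_pos j with rfl | h
    · simp [moebiusCoeff]
    · exact (moebiusCoeff_pos h).le
  simp only [fixedPointDenom, Finset.prod_const, Finset.card_range, one_pow, one_mul]
  have := mul_nonneg h3 (sub_nonneg.2 h1)
  linarith

theorem exists_fixedPoint (n : ℕ) (a b c : ℕ → ℂˣ)
    (hN : ∏ i ∈ Finset.range n, (a i : ℂ) - ∏ i ∈ Finset.range n, (b i : ℂ) ≠ 0)
    (hK : ∀ j ≤ n, fixedPointDenom n (fun i => (a i : ℂ)) (fun i => (b i : ℂ))
      (fun i => (c i : ℂ)) j ≠ 0) :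
    ∃ X D : ℕ → ℂˣ, X n = X 0 ∧ ∀ j < n, (D j : ℂ) = X j * c j + b j ∧
      X (j + 1) = a j * X j / D j := by
  obtain ⟨K, hKK⟩ : ∃ K : ℕ → ℂˣ, ∀ j ≤ n, (K j : ℂ) = fixedPointDenom n (fun i => (a i : ℂ))
      (fun i => (b i : ℂ)) (fun i => (c i : ℂ)) j := by
    have h : ∀ j, ∃ u : ℂˣ, j ≤ n → (u : ℂ) = fixedPointDenom n (fun i => (a i : ℂ))
        (fun i => (b i : ℂ)) (fun i => (c i : ℂ)) j := fun j => by
      by_cases hj : j ≤ n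
      · exact ⟨Units.mk0 _ (hK j hj), fun _ => rfl⟩
      · exact ⟨1, fun h => absurd h hj⟩
    choose K hK' using h
    exact ⟨K, hK'⟩
  refine ⟨fun j => (∏ i ∈ Finset.range j, a i) * Units.mk0 _ hN / K j,
    fun j => K (j + 1) / K j, ?_, fun j hj => ⟨?_, ?_⟩⟩
  · have h : K n = (∏ i ∈ Finset.range n, a i) * K 0 := by
      ext
      push_cast
      rw [hKK n le_rfl, hKK 0 (Nat.zero_le n), fixedPointDenom_self]
    simp [h, mul_div_mul_left_eq_div]
  · push_cast
    have h1 := (K j).ne_zero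
    rw [Units.val_mk0, hKK (j + 1) hj, fixedPointDenom_succ, ← hKK j hj.le]
    field_simp
  · simp only [Finset.prod_range_succ]
    ext
    push_cast
    have h1 := (K j).ne_zero
    have h2 := (K (j + 1)).ne_zero
    field_simp

/-! ### Existence of the transformation -/

theorem insertBefore_comm {F : Type*} [DecidableEq F] {e f g : F} (hef : e ≠ f) (heg : e ≠ g)
    (hfg : f ≠ g) (σ : Perm F) :
    insertBefore f e (insertBefore e g σ) = insertBefore e g (insertBefore f g σ) := by
  ext z
  simp only [insertBefore, Perm.mul_apply, swap_apply_def]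
  grind

namespace BipartiteMap
variable {E : Type*} [DecidableEq E] {M : BipartiteMap E}
namespace HexChain
variable {n : ℕ} (H : M.HexChain n)

/-- The rotation at the black vertices after an edge `inr false` has been inserted into `f_k`. -/
def blackWithEdge (k : ZMod n) : Perm (E ⊕ Bool) :=
  insertBefore (Sum.inr false) (Sum.inl (H.q k)) (Perm.sumCongr M.black 1)

/-- The rotation at the white vertices after an edge `inr false` has been inserted into `f_k`. -/
def whiteWithEdge (k : ZMod n) : Perm (E ⊕ Bool) :=
  insertBefore (Sum.inr false) (Sum.inl (H.s k)) (Perm.sumCongr M.white 1)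

theorem blackWithEdge_inl (k : ZMod n) (e : E) : H.blackWithEdge k (Sum.inl e) =
    if M.black e = H.q k then Sum.inr false else Sum.inl (M.black e) := by
  rw [blackWithEdge, insertBefore_apply (by simp)]
  simp

theorem whiteWithEdge_inl (k : ZMod n) (e : E) : H.whiteWithEdge k (Sum.inl e) =
    if M.white e = H.s k then Sum.inr false else Sum.inl (M.white e) := by
  rw [whiteWithEdge, insertBefore_apply (by simp)]
  simp

theorem blackWithEdge_inr_true (k : ZMod n) : H.blackWithEdge k (Sum.inr true) = Sum.inr true := by
  rw [blackWithEdge, insertBefore_apply (by simp)]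
  simp

theorem whiteWithEdge_inr_true (k : ZMod n) : H.whiteWithEdge k (Sum.inr true) = Sum.inr true := by
  rw [whiteWithEdge, insertBefore_apply (by simp)]
  simp

theorem blackWithEdge_p (k z : ZMod n) : H.blackWithEdge k (Sum.inl (H.p z)) =
    if z = k then Sum.inr false else Sum.inl (H.q z) := by
  simp only [blackWithEdge_inl, H.black_p, H.q_injective.eq_iff]

theorem whiteWithEdge_t (k z : ZMod n) : H.whiteWithEdge k (Sum.inl (H.t z)) =
    if z = k then Sum.inr false else Sum.inl (H.s z) := by
  simp only [whiteWithEdge_inl, H.white_t, H.s_injective.eq_iff]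

/-- The graph with a second edge `inr true` from `bl z` to `wr z` in `f_z`, inserted next to the
rung `r (z + 1)`; in `f_k` it lies above the edge `inr false`. -/
def belowRung (k z : ZMod n) : BipartiteMap (E ⊕ Bool) where
  black := insertBefore (Sum.inr true) (Sum.inl (H.q z)) (H.blackWithEdge k)
  white := insertBefore (Sum.inr true) (H.whiteWithEdge k (Sum.inl (H.t z))) (H.whiteWithEdge k)

/-- The graph with a second edge `inr true` from `bl z` to `wr z` in `f_z`, inserted next to the
rung `r z`; in `f_k` it lies below the edge `inr false`. -/
def aboveRung (k z : ZMod n) : BipartiteMap (E ⊕ Bool) where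
  black := insertBefore (Sum.inr true) (H.blackWithEdge k (Sum.inl (H.p z))) (H.blackWithEdge k)
  white := insertBefore (Sum.inr true) (Sum.inl (H.s z)) (H.whiteWithEdge k)

theorem aboveRung_eq_belowRung {k z : ZMod n} (h : z ≠ k) : H.aboveRung k z = H.belowRung k z := by
  simp [aboveRung, belowRung, blackWithEdge_p, whiteWithEdge_t, h]

theorem insertBigon_false (k : ZMod n) (y : ℂˣ) (wt : E → ℂˣ) :
    H.insertBigon k false y wt =
      ⟨H.belowRung k k, Sum.elim wt (fun i => if i = false then y else -y)⟩ := by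
  simp only [insertBigon, belowRung, whiteWithEdge_t, if_true, Bool.not_false]
  rw [insertBefore_comm (by simp) (by simp) (by simp)]
  rfl

theorem insertBigon_true (k : ZMod n) (y : ℂˣ) (wt : E → ℂˣ) :
    H.insertBigon k true y wt =
      ⟨H.aboveRung k k, Sum.elim wt (fun i => if i = true then y else -y)⟩ := by
  simp only [insertBigon, aboveRung, blackWithEdge_p, if_true, Bool.not_true]
  rw [insertBefore_comm (e := Sum.inr true) (f := Sum.inr false) (by simp) (by simp) (by simp)]
  rfl

variable {H}

/-- The move across the rung `r (z + 1)`.  It is also available across the last rung `r k`, after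
which the edge arrives in `f_k` below `inr false`. -/
theorem spiderAcrossRung_belowRung (hinj : Function.Injective H.edge) (k z : ZMod n)
    {w w' : E ⊕ Bool → ℂˣ} {Δ : ℂˣ}
    (hw : IsRungWeightChange w w' (Sum.inr true) (Sum.inl (H.q z)) (Sum.inl (H.r (z + 1)))
      (Sum.inl (H.t z)) (Sum.inl (H.p (z + 1))) (Sum.inl (H.s (z + 1))) Δ) :
    SpiderAcrossRung ⟨H.belowRung k z, w⟩ ⟨H.aboveRung k (z + 1), w'⟩ (Sum.inr true)
      (Sum.inl (H.q z)) (Sum.inl (H.r (z + 1))) (Sum.inl (H.t z)) (Sum.inl (H.p (z + 1)))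
      (Sum.inl (H.s (z + 1))) := by
  have hne : ∀ (z z' : ZMod n) (c c' : Fin 5), c ≠ c' → H.edge (z, c) ≠ H.edge (z', c') :=
    fun z z' c c' hc h => hc (Prod.ext_iff.1 (hinj h)).2
  have hps : ∀ i j, H.p i ≠ H.s j := H.p_ne_s
  have hqs : ∀ i j, H.q i ≠ H.s j := fun i j => by
    simpa [edge] using hne i (j - 1) 0 4 (by decide)
  have hqp : ∀ i j, H.q i ≠ H.p j := fun i j => by
    simpa [edge] using hne i (j - 1) 0 3 (by decide)
  have hrs : ∀ i j, H.r i ≠ H.s j := fun i j => by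
    simpa [edge] using hne (i - 1) (j - 1) 1 4 (by decide)
  refine spiderAcrossRung_of_isRungWeightChange (H.blackWithEdge k) (H.whiteWithEdge k) w w'
    (nodup_rung hinj z) (H.blackWithEdge_inr_true k) (H.whiteWithEdge_inr_true k) ?_ ?_ ?_ ?_ ?_ ?_
    ?_ ?_ hw
  · simp [whiteWithEdge_inl, H.white_q, hrs]
  · simp [whiteWithEdge_inl, H.white_r, hps]
  · simp [whiteWithEdge_inl, H.white_p, hqs]
  · simp [blackWithEdge_inl, H.black_r, (H.q_ne_t _ _).symm]
  · simp [blackWithEdge_inl, H.black_t, (hqs _ _).symm]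
  · simp [blackWithEdge_inl, H.black_s, (H.q_ne_r _ _).symm]
  · rw [blackWithEdge_inl]
    split_ifs with h
    · simp
    · intro h'
      rw [Sum.inl.injEq] at h'
      exact hqp z z (M.black.injective (h'.trans (H.black_p z).symm))
  · rw [blackWithEdge_p]
    split_ifs
    · simp
    · simpa using hqp _ _

variable [NeZero n]

/-- The new weights of the five edges at a rung. -/
def rungWeights (H : M.HexChain n) (wt : E → ℂˣ) (Δ : ℂˣ) (z : ZMod n) : Fin 5 → ℂˣ :=
  ![1, wt (H.r (z + 1)) / Δ, 1, wt (H.p (z + 1)) * wt (H.t z) / Δ,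
    wt (H.s (z + 1)) * wt (H.q z) / Δ]

open scoped Classical in
/-- The weights after the bigon edge has moved across `j` rungs, for given weights `X i` of the
bigon edge and denominators `D i` of the spider moves. -/
noncomputable def stageWeights (H : M.HexChain n) (k : ZMod n) (wt : E → ℂˣ) (y : ℂˣ)
    (X D : ℕ → ℂˣ) (j : ℕ) : E ⊕ Bool → ℂˣ :=
  Sum.elim (Function.extend H.edge (fun z => if (z.1 - k).val < j then
    H.rungWeights wt (D (z.1 - k).val) z.1 z.2 else wt (H.edge z)) wt)
    (fun i => if i = false then y else X j)

theorem isWeightSequence_stageWeights (hinj : Function.Injective H.edge) (k : ZMod n)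
    (wt : E → ℂˣ) (y : ℂˣ) (X D : ℕ → ℂˣ)
    (hD : ∀ j < n, (D j : ℂ) = X j * wt (H.r (k + j + 1)) +
      wt (H.q (k + j)) * wt (H.t (k + j)))
    (hX : ∀ j < n, X (j + 1) = wt (H.s (k + j + 1)) * wt (H.p (k + j + 1)) * X j / D j) :
    H.IsWeightSequence k (H.stageWeights k wt y X D) D := by
  intro j hj
  have hval : (k + (j : ZMod n) - k).val = j := by
    rw [add_sub_cancel_left, ZMod.val_cast_of_lt hj]
  have hb : ∀ c, H.stageWeights k wt y X D j (Sum.inl (H.edge (k + j, c))) =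
      wt (H.edge (k + j, c)) := fun c => by
    simp only [stageWeights, Sum.elim_inl, hinj.extend_apply, hval]
    simp
  have ha : ∀ c, H.stageWeights k wt y X D (j + 1) (Sum.inl (H.edge (k + j, c))) =
      H.rungWeights wt (D j) (k + j) c := fun c => by
    simp only [stageWeights, Sum.elim_inl, hinj.extend_apply, hval]
    simp
  have hx : ∀ i, H.stageWeights k wt y X D i (Sum.inr true) = X i := fun i => by
    simp [stageWeights]
  have hb0 : H.stageWeights k wt y X D j (Sum.inl (H.q (k + j))) = _ := hb 0
  have hb1 : H.stageWeights k wt y X D j (Sum.inl (H.r (k + j + 1))) = _ := hb 1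
  have hb2 : H.stageWeights k wt y X D j (Sum.inl (H.t (k + j))) = _ := hb 2
  have hb3 : H.stageWeights k wt y X D j (Sum.inl (H.p (k + j + 1))) = _ := hb 3
  have hb4 : H.stageWeights k wt y X D j (Sum.inl (H.s (k + j + 1))) = _ := hb 4
  constructor
  · rw [hx, hb0, hb1, hb2, hD j hj]; rfl
  · rw [hx, hx, hb3, hb4, hX j hj]; rfl
  · exact ha 0
  · rw [hb1]; exact ha 1
  · exact ha 2
  · rw [hb3, hb2]; exact ha 3
  · rw [hb4, hb0]; exact ha 4
  · rintro (e | i) he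
    · by_cases h : e ∈ Set.range H.edge
      · obtain ⟨⟨z, c⟩, rfl⟩ := h
        have hz : (z - k).val ≠ j := by
          intro h
          have hz : z = k + j := by
            rw [← h]; simp
          subst hz
          revert he
          fin_cases c <;> simp [edge]
        have : (z - k).val < j + 1 ↔ (z - k).val < j := by lia
        simp only [stageWeights, Sum.elim_inl, hinj.extend_apply, this]
      · simp only [stageWeights, Sum.elim_inl, Function.extend_apply' _ _ _ h]
    · cases i
      · simp [stageWeights]
      · simp at he

theorem exists_rMatrixWeights (hinj : Function.Injective H.edge) (k : ZMod n)
    (wt : E → ℂˣ) (X D : ℕ → ℂˣ) (hXn : X n = X 0)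
    (hD : ∀ j < n, (D j : ℂ) = X j * wt (H.r (k + j + 1)) +
      wt (H.q (k + j)) * wt (H.t (k + j)))
    (hX : ∀ j < n, X (j + 1) = wt (H.s (k + j + 1)) * wt (H.p (k + j + 1)) * X j / D j) :
    ∃ wt', H.RMatrixWeights k wt wt' := by
  have hseq := isWeightSequence_stageWeights hinj k wt (-X 0) X D hD hX
  set w := H.stageWeights k wt (-X 0) X D with hw
  have hn : 0 < n := Nat.pos_of_ne_zero (NeZero.ne n)
  refine ⟨fun e => w n (Sum.inl e), -X 0, X 0,
    fun j => if j < n then ⟨H.belowRung k (k + j), w j⟩ else ⟨H.aboveRung k (k + j), w j⟩,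
    ?_, ?_, ?_⟩
  · simp only [hn, if_true, insertBigon_false, Nat.cast_zero, add_zero]
    congr 1
    funext e
    rcases e with e | i
    · by_cases h : e ∈ Set.range H.edge
      · obtain ⟨z, rfl⟩ := h
        simp [hw, stageWeights, hinj.extend_apply]
      · simp only [hw, stageWeights, Sum.elim_inl, Function.extend_apply' _ _ _ h]
    · cases i <;> simp [hw, stageWeights]
  · intro j hj
    have h := spiderAcrossRung_belowRung hinj k (k + j) (hseq j hj)
    have hc : k + ((j + 1 : ℕ) : ZMod n) = k + j + 1 := by push_cast; ring
    simp only [hj, if_true, hc]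
    split_ifs with hj'
    · rwa [aboveRung_eq_belowRung] at h
      intro h'
      rw [← hc] at h'
      have := natCast_inj (k := k) hj' hn (by simpa using h')
      lia
    · exact h
  · simp only [lt_irrefl, if_false, insertBigon_true, CharP.cast_eq_zero, add_zero]
    congr 1
    funext e
    rcases e with e | i
    · rfl
    · cases i <;> simp [hw, stageWeights, hXn]

/-- The transformation is defined outside the zero set of a polynomial.  The polynomial does not
vanish where all edges `p` have weight `2` and all other edges have weight `1`. -/
theorem exists_polynomial (hinj : Function.Injective H.edge) (k : ZMod n) :
    ∃ P : MvPolynomial E ℂ, P ≠ 0 ∧ ∀ wt : E → ℂˣ,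
      MvPolynomial.eval (fun e => (wt e : ℂ)) P ≠ 0 → ∃ wt', H.RMatrixWeights k wt wt' := by
  have hn : 0 < n := Nat.pos_of_ne_zero (NeZero.ne n)
  let a : ℕ → MvPolynomial E ℂ := fun j =>
    MvPolynomial.X (H.s (k + j + 1)) * MvPolynomial.X (H.p (k + j + 1))
  let b : ℕ → MvPolynomial E ℂ := fun j => MvPolynomial.X (H.q (k + j)) * MvPolynomial.X (H.t (k + j))
  let c : ℕ → MvPolynomial E ℂ := fun j => MvPolynomial.X (H.r (k + j + 1))
  refine ⟨(∏ i ∈ Finset.range n, a i - ∏ i ∈ Finset.range n, b i) *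
    ∏ j ∈ Finset.range (n + 1), fixedPointDenom n a b c j, ?_, fun wt hwt => ?_⟩
  · intro h0
    have hne : ∀ (z z' : ZMod n) (c c' : Fin 5), c ≠ c' → H.edge (z, c) ≠ H.edge (z', c') :=
      fun z z' c c' hc h => hc (Prod.ext_iff.1 (hinj h)).2
    classical
    have h := congrArg
      (MvPolynomial.eval (fun e => if ∃ z, e = H.edge (z, 3) then (2 : ℂ) else 1)) h0
    have hp : ∀ z, ∃ z', H.p (z + 1) = H.edge (z', 3) := fun z => ⟨z, rfl⟩
    have hq : ∀ z, ¬ ∃ z', H.q z = H.edge (z', 3) := fun z ⟨z', h⟩ => hne z z' 0 3 (by decide) h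
    have hr : ∀ z, ¬ ∃ z', H.r (z + 1) = H.edge (z', 3) := fun z ⟨z', h⟩ =>
      hne z z' 1 3 (by decide) h
    have ht : ∀ z, ¬ ∃ z', H.t z = H.edge (z', 3) := fun z ⟨z', h⟩ => hne z z' 2 3 (by decide) h
    have hs : ∀ z, ¬ ∃ z', H.s (z + 1) = H.edge (z', 3) := fun z ⟨z', h⟩ =>
      hne z z' 4 3 (by decide) h
    simp only [map_mul, map_sub, map_prod, map_fixedPointDenom, a, b, c, MvPolynomial.eval_X,
      if_pos (hp _), if_neg (hq _), if_neg (hr _), if_neg (ht _), if_neg (hs _), one_mul,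
      map_zero, Finset.prod_const, Finset.card_range, one_pow] at h
    rcases mul_eq_zero.1 h with h | h
    · have : (2 : ℝ) ^ n = 1 := by exact_mod_cast sub_eq_zero.1 h
      exact (one_lt_pow₀ (by norm_num : (1 : ℝ) < 2) hn.ne').ne' this
    · obtain ⟨j, -, hj⟩ := Finset.prod_eq_zero_iff.1 h
      have h2 := map_fixedPointDenom Complex.ofRealHom n (fun _ => (2 : ℝ)) (fun _ => 1)
        (fun _ => 1) j
      simp only [Complex.ofRealHom_eq_coe, Complex.ofReal_ofNat, Complex.ofReal_one] at h2
      rw [hj, Complex.ofReal_eq_zero] at h2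
      exact (fixedPointDenom_pos hn j).ne' h2
  · simp only [map_mul, map_sub, map_prod, map_fixedPointDenom, a, b, c, MvPolynomial.eval_X] at hwt
    obtain ⟨hN, hK⟩ := mul_ne_zero_iff.1 hwt
    rw [Finset.prod_ne_zero_iff] at hK
    obtain ⟨X, D, hXn, h⟩ := exists_fixedPoint n
      (fun j => wt (H.s (k + j + 1)) * wt (H.p (k + j + 1)))
      (fun j => wt (H.q (k + j)) * wt (H.t (k + j))) (fun j => wt (H.r (k + j + 1)))
      (by simpa using hN) (fun j hj => by simpa using hK j (by simpa [Nat.lt_succ_iff] using hj))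
    exact exists_rMatrixWeights hinj k wt X D hXn (fun j hj => by simpa using (h j hj).1)
      (fun j hj => (h j hj).2)

/-- Every geometric R-matrix transformation changes the weights as `IsTurnWeightChange` describes:
the bigon edge has the same weight `-y` before the first and after the last spider move, since the
other edge of the bigon keeps its weight `y`. -/
theorem RMatrixWeights.exists_isTurnWeightChange (hinj : Function.Injective H.edge) {k : ZMod n}
    {wt wt' : E → ℂˣ} (h : H.RMatrixWeights k wt wt') :
    ∃ Δ, IsTurnWeightChange H wt wt' Δ := by
  obtain ⟨y, y', G, h0, hs, hn⟩ := h
  have hex : ∀ j, ∃ Δ, j < n → IsRungWeightChange (G j).wt (G (j + 1)).wt (Sum.inr true)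
      (Sum.inl (H.q (k + j))) (Sum.inl (H.r (k + j + 1))) (Sum.inl (H.t (k + j)))
      (Sum.inl (H.p (k + j + 1))) (Sum.inl (H.s (k + j + 1))) Δ := by
    intro j
    by_cases hj : j < n
    · obtain ⟨Δ, hΔ⟩ := (hs j hj).exists_isRungWeightChange (nodup_rung hinj _)
      exact ⟨Δ, fun _ => hΔ⟩
    · exact ⟨1, fun h => absurd h hj⟩
  choose D hD using hex
  have hseq : H.IsWeightSequence k (fun j => (G j).wt) D := hD
  have hfalse : ∀ j ≤ n, (G j).wt (Sum.inr false) = (G 0).wt (Sum.inr false) := by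
    intro j hj
    induction j with
    | zero => rfl
    | succ j ih =>
      rw [← ih (by lia)]
      exact (hseq j hj).wt_of_ne _ (by simp)
  have hy := hfalse n le_rfl
  have hturn := hseq.isTurnWeightChange hinj (by
    simp only [hn, h0, insertBigon, Sum.elim_inr] at hy ⊢
    simpa [neg_eq_iff_eq_neg] using hy)
  simp only [hn, h0, insertBigon, Sum.elim_inl] at hturn
  exact ⟨_, hturn⟩

end HexChain
end BipartiteMap
end TorusDimer

theorem proposition4p1 {E : Type*} [Fintype E] [DecidableEq E]
    (M : TorusDimer.BipartiteMap E) (hT : M.IsTorus) (hM : M.IsMinimal)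
    (n : ℕ) (hn : 1 ≤ n) (H : M.HexChain n) (hH : H.left ≠ H.right) (k : ZMod n) :
    (∃ P : MvPolynomial E ℂ, P ≠ 0 ∧ ∀ wt : E → ℂˣ,
      MvPolynomial.eval (fun e => (wt e : ℂ)) P ≠ 0 → ∃ ω' : M.X, H.RMatrix k (M.toX wt) ω') ∧
    ∀ ω ω' : M.X, H.RMatrix k ω ω' →
      M.C H.left ω' = M.C H.right ω ∧
      M.C H.right ω' = M.C H.left ω ∧
      ∀ α : M.Zigzag, α ≠ H.left → α ≠ H.right → M.C α ω' = M.C α ω := by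
  have : NeZero n := ⟨by lia⟩
  have hinj := H.edge_injective hM hH
  constructor
  · -- The given weight itself represents its class.
    obtain ⟨P, hP, h⟩ := TorusDimer.BipartiteMap.HexChain.exists_polynomial hinj k
    refine ⟨P, hP, fun wt hwt => ?_⟩
    obtain ⟨wt', hwt'⟩ := h wt hwt
    exact ⟨M.toX wt', wt, wt', rfl, rfl, hwt'⟩
  · rintro _ _ ⟨wt, wt', rfl, rfl, h⟩
    obtain ⟨Δ, hΔ⟩ := h.exists_isTurnWeightChange hinj
    refine ⟨?_, ?_, fun α hl hr => ?_⟩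
    · rw [hΔ.C_toX hinj, if_pos rfl, if_neg hH.symm, sub_zero, zpow_one,
        TorusDimer.BipartiteMap.HexChain.C_left_toX hinj hH,
        TorusDimer.BipartiteMap.HexChain.C_right_toX hinj hH, ← Finset.prod_mul_distrib]
      refine Finset.prod_congr rfl fun z _ => ?_
      ext
      push_cast
      field_simp
    · rw [hΔ.C_toX hinj, if_neg hH, if_pos rfl, zero_sub, zpow_neg_one, ← Finset.prod_inv_distrib,
        TorusDimer.BipartiteMap.HexChain.C_left_toX hinj hH,
        TorusDimer.BipartiteMap.HexChain.C_right_toX hinj hH, ← Finset.prod_mul_distrib]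
      refine Finset.prod_congr rfl fun z _ => ?_
      ext
      push_cast
      field_simp
    · rw [hΔ.C_toX hinj, if_neg (Ne.symm hl), if_neg (Ne.symm hr), sub_zero, zpow_zero, mul_one]
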